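/- Let $\mathbf K_0$ be a connected compact Lie group with Lie algebra $\mathfrak k_0$, let $\mathfrak k=\mathbb C\otimes_{\mathbb R}\mathfrak k_0$ with conjugation $X\mapsto\bar X$ with respect to $\mathfrak k_0$, let $\mathbf M_0$ be a closed subgroup of $\mathbf K_0$ and $\mathfrak v$ a complex Lie subalgebra of $\mathfrak k$ (for instance the isotropy subgroup and the $CR$ algebra at a point of a $\mathbf K_0$-homogeneous $CR$ manifold). A subalgebra of $\mathfrak k$ is parabolic if it contains a Borel (maximal solvable) subalgebra of $\mathfrak k$. Let $\mathfrak n_r(\mathfrak v)$ be the set of those $X$ in the radical of $\mathfrak v$ for which $X\in[\mathfrak k,\mathfrak k]$ and $\mathrm{ad}_{\mathfrak k}(X)$ is nilpotent, and put $\mathfrak L(\mathfrak q)=\mathfrak q\cap\bar{\mathfrak q}$. Let $\mathrm{Par}(\mathfrak v,\mathbf M_0)$ be the set of parabolic subalgebras $\mathfrak q$ of $\mathfrak k$ such that $\mathfrak v\subset\mathfrak q$, $\mathfrak n_r(\mathfrak v)\cap\mathfrak L(\mathfrak q)=\{0\}$, and $\mathrm{Ad}_{\mathfrak k}(g)(\mathfrak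 q)=\mathfrak q$ for all $g\in\mathbf M_0$. For $A\in\mathfrak k_0$ set $$\mathfrak q_A=\sum_{\lambda\ge 0}\{X\in\mathfrak k\mid [A,X]=i\lambda X\},$$ where $\lambda$ ranges over the non-negative real numbers, and set $$\mathfrak a_0(\mathbf M_0)=\{A\in\mathfrak k_0\mid \mathrm{Ad}(g)(A)=A\ \ \forall g\in\mathbf M_0\}.$$ Then $$\mathrm{Par}(\mathfrak v,\mathbf M_0)=\{\mathfrak q_A\mid A\in\mathfrak a_0(\mathbf M_0),\ \mathfrak v\subset\mathfrak q_A,\ \mathfrak n_r(\mathfrak v)\cap\mathfrak L(\mathfrak q_A)=\{0\}\}.$$ Moreover, without the condition on $\mathfrak n_r(\mathfrak v)$ on either side: the set of all parabolic subalgebras $\mathfrak q$ of $\mathfrak k$ with $\mathfrak v\subset\mathfrak q$ and $\mathrm{Ad}_{\mathfrak k}(g)(\mathfrak q)=\mathfrak q$ for all $g\in\mathbf M_0$ is exactly $\{\mathfrak q_A\mid A\in\mathfrak a_0(\mathbf M_0),\ \mathfrak v\subset\mathfrak q_A\}$. -/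

import Mathlib

open scoped Manifold ContDiff TensorProduct

noncomputable section

namespace CRLie

/-! ### Parabolic subalgebras and nilpotent elements -/

/-- A Borel subalgebra: a maximal solvable subalgebra. -/
def IsBorel {𝔨 : Type*} [LieRing 𝔨] [LieAlgebra ℂ 𝔨] (𝔟 : LieSubalgebra ℂ 𝔨) : Prop :=
  Maximal (fun 𝔰 : LieSubalgebra ℂ 𝔨 => LieAlgebra.IsSolvable 𝔰) 𝔟

/-- A parabolic subalgebra: a subalgebra containing a Borel subalgebra. -/
def IsParabolic {𝔨 : Type*} [LieRing 𝔨] [LieAlgebra ℂ 𝔨] (𝔮 : LieSubalgebra ℂ 𝔨) : Prop :=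
  ∃ 𝔟 : LieSubalgebra ℂ 𝔨, IsBorel 𝔟 ∧ 𝔟 ≤ 𝔮

/-- `X` is a nilpotent element of the reductive Lie algebra `𝔨`: it belongs to `[𝔨, 𝔨]` and
`ad X` is a nilpotent endomorphism of `𝔨`. -/
def IsNilpotentElement {𝔨 : Type*} [LieRing 𝔨] [LieAlgebra ℂ 𝔨] (X : 𝔨) : Prop :=
  X ∈ LieAlgebra.derivedSeries ℂ 𝔨 1 ∧ IsNilpotent (LieAlgebra.ad ℂ 𝔨 X)

/-- `𝔫_r(𝔳)`: the elements of the radical of `𝔳` that are nilpotent elements of `𝔨`. -/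
def nilr {𝔨 : Type*} [LieRing 𝔨] [LieAlgebra ℂ 𝔨] (𝔳 : LieSubalgebra ℂ 𝔨) : Set 𝔨 :=
  {X | (∃ Y : 𝔳, Y ∈ LieAlgebra.radical ℂ 𝔳 ∧ (Y : 𝔨) = X) ∧ IsNilpotentElement X}

/-! ### The sum of the eigenspaces with non-negative imaginary eigenvalue -/

/-- The linear span `∑_{l ≥ 0} {X ∈ 𝔨 | [H, X] = i l X}`. -/
def nonnegEigenSubmodule {𝔨 : Type*} [LieRing 𝔨] [LieAlgebra ℂ 𝔨] (H : 𝔨) : Submodule ℂ 𝔨 :=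
  ⨆ l : {x : ℝ // 0 ≤ x},
    Module.End.eigenspace (LieAlgebra.ad ℂ 𝔨 H) (Complex.I * ((l : ℝ) : ℂ))

theorem lie_mem_nonnegEigenSubmodule {𝔨 : Type*} [LieRing 𝔨] [LieAlgebra ℂ 𝔨] (H : 𝔨)
    {X Y : 𝔨} (hX : X ∈ nonnegEigenSubmodule H) (hY : Y ∈ nonnegEigenSubmodule H) :
    ⁅X, Y⁆ ∈ nonnegEigenSubmodule H := by
  refine Submodule.iSup_induction _ (motive := fun X => ⁅X, Y⁆ ∈ nonnegEigenSubmodule H) hX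
    (fun l X hX => ?_) (by simp) (fun X X' h h' => by rw [add_lie]; exact add_mem h h')
  refine Submodule.iSup_induction _ (motive := fun Y => ⁅X, Y⁆ ∈ nonnegEigenSubmodule H) hY
    (fun m Y hY => ?_) (by simp) (fun Y Y' h h' => by rw [lie_add]; exact add_mem h h')
  rw [Module.End.mem_eigenspace_iff, LieAlgebra.ad_apply] at hX hY
  refine Submodule.mem_iSup_of_mem ⟨l + m, add_nonneg l.2 m.2⟩ ?_
  rw [Module.End.mem_eigenspace_iff, LieAlgebra.ad_apply, leibniz_lie, hX, hY, smul_lie,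
    lie_smul, ← add_smul]
  push_cast
  rw [mul_add]

/-- The same span as a Lie subalgebra. -/
def nonnegEigen {𝔨 : Type*} [LieRing 𝔨] [LieAlgebra ℂ 𝔨] (H : 𝔨) : LieSubalgebra ℂ 𝔨 :=
  { nonnegEigenSubmodule H with lie_mem' := fun hX hY => lie_mem_nonnegEigenSubmodule H hX hY }

/-! ### The complexification of a real Lie algebra -/

/-- Conjugation of `ℂ ⊗ 𝔨₀` with respect to the real form `𝔨₀`: `z ⊗ X ↦ z̄ ⊗ X`. -/
def conjC (𝔨₀ : Type*) [LieRing 𝔨₀] [LieAlgebra ℝ 𝔨₀] :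
    (ℂ ⊗[ℝ] 𝔨₀) →ₗ[ℝ] (ℂ ⊗[ℝ] 𝔨₀) :=
  LinearMap.rTensor 𝔨₀ Complex.conjAe.toLinearMap

/-- `𝔏(𝔮) = 𝔮 ∩ 𝔮̄`. -/
def leviPart {𝔨₀ : Type*} [LieRing 𝔨₀] [LieAlgebra ℝ 𝔨₀]
    (𝔮 : LieSubalgebra ℂ (ℂ ⊗[ℝ] 𝔨₀)) : Set (ℂ ⊗[ℝ] 𝔨₀) :=
  (𝔮 : Set (ℂ ⊗[ℝ] 𝔨₀)) ∩ conjC 𝔨₀ '' (𝔮 : Set (ℂ ⊗[ℝ] 𝔨₀))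

/-- The subalgebra `𝔮_A`, the sum of the eigenspaces of `ad A` on `𝔨 = ℂ ⊗ 𝔨₀` for the
eigenvalues `i l` with `l ≥ 0`. -/
def q {𝔨₀ : Type*} [LieRing 𝔨₀] [LieAlgebra ℝ 𝔨₀] (A : 𝔨₀) :
    LieSubalgebra ℂ (ℂ ⊗[ℝ] 𝔨₀) :=
  nonnegEigen ((1 : ℂ) ⊗ₜ[ℝ] A)

/-- `Par(𝔳)`: the parabolic subalgebras `𝔮` of `𝔨` with `𝔳 ⊆ 𝔮` and `𝔫_r(𝔳) ∩ 𝔏(𝔮) = {0}`. -/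
def Par {𝔨₀ : Type*} [LieRing 𝔨₀] [LieAlgebra ℝ 𝔨₀]
    (𝔳 : LieSubalgebra ℂ (ℂ ⊗[ℝ] 𝔨₀)) : Set (LieSubalgebra ℂ (ℂ ⊗[ℝ] 𝔨₀)) :=
  {𝔮 | IsParabolic 𝔮 ∧ 𝔳 ≤ 𝔮 ∧ nilr 𝔳 ∩ leviPart 𝔮 = {0}}

/-! ### Lie groups -/

/-- A smooth real Lie group is a Lie group of the class which is needed for the Lie bracket on
`GroupLieAlgebra`. -/
instance lieGroupMinSmoothness {E : Type*} [NormedAddCommGroup E] [NormedSpace ℝ E]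
    {G : Type*} [TopologicalSpace G] [ChartedSpace E G] [Group G] [LieGroup 𝓘(ℝ, E) ∞ G] :
    LieGroup 𝓘(ℝ, E) (minSmoothness ℝ 3) G :=
  LieGroup.of_le (n := ∞) (by
    rw [minSmoothness_of_isRCLikeNormedField]
    exact WithTop.coe_le_coe.2 le_top)

/-- `Ad(g)`: the differential at the identity of `h ↦ g h g⁻¹`. -/
def Ad {E : Type*} [NormedAddCommGroup E] [NormedSpace ℝ E]
    {G : Type*} [TopologicalSpace G] [ChartedSpace E G] [Group G] (g : G) :
    GroupLieAlgebra 𝓘(ℝ, E) G →ₗ[ℝ] GroupLieAlgebra 𝓘(ℝ, E) G :=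
  (mfderiv 𝓘(ℝ, E) 𝓘(ℝ, E) (fun h : G => g * h * g⁻¹) (1 : G) : E →L[ℝ] E).toLinearMap

/-- The subalgebra `𝔮` of `𝔨 = ℂ ⊗ Lie(G)` satisfies `Ad_𝔨(g)(𝔮) = 𝔮`, where `Ad_𝔨(g)` is
the `ℂ`-linear extension of `Ad(g)`. -/
def AdStable {E : Type*} [NormedAddCommGroup E] [NormedSpace ℝ E] [CompleteSpace E]
    {G : Type*} [TopologicalSpace G] [ChartedSpace E G] [Group G] [LieGroup 𝓘(ℝ, E) ∞ G]
    (g : G) (𝔮 : LieSubalgebra ℂ (ℂ ⊗[ℝ] GroupLieAlgebra 𝓘(ℝ, E) G)) : Prop :=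
  Submodule.map ((Ad g).baseChange ℂ) 𝔮.toSubmodule = 𝔮.toSubmodule

/-- `Par(𝔳, M₀)`: the elements `𝔮` of `Par(𝔳)` with `Ad_𝔨(g)(𝔮) = 𝔮` for all `g ∈ M₀`. -/
def ParAdm {E : Type*} [NormedAddCommGroup E] [NormedSpace ℝ E] [CompleteSpace E]
    {G : Type*} [TopologicalSpace G] [ChartedSpace E G] [Group G] [LieGroup 𝓘(ℝ, E) ∞ G]
    (𝔳 : LieSubalgebra ℂ (ℂ ⊗[ℝ] GroupLieAlgebra 𝓘(ℝ, E) G)) (M₀ : Subgroup G) :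
    Set (LieSubalgebra ℂ (ℂ ⊗[ℝ] GroupLieAlgebra 𝓘(ℝ, E) G)) :=
  {𝔮 | 𝔮 ∈ Par 𝔳 ∧ ∀ g ∈ M₀, AdStable g 𝔮}

/-- `𝔞₀(M₀)`: the elements of `𝔨₀ = Lie(G)` fixed by `Ad(M₀)`. -/
def adFixed {E : Type*} [NormedAddCommGroup E] [NormedSpace ℝ E]
    {G : Type*} [TopologicalSpace G] [ChartedSpace E G] [Group G]
    (M₀ : Subgroup G) : Set (GroupLieAlgebra 𝓘(ℝ, E) G) :=
  {A | ∀ g ∈ M₀, Ad g A = A}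

end CRLie

end

/-! Averaging over the compact group gives an `Ad`-invariant inner product on 𝔨₀, which can be
chosen as minus the Killing form plus a term carried by the center. It extends to a bilinear form B
on 𝔨, and ⟪x, y⟫ = B(x̄, y) is a Hermitian product for which the adjoint of ad x is -ad x̄. This
replaces root systems throughout.

From a parabolic 𝔮 the element A is recovered canonically. Let P be the orthogonal projection to 𝔮
and a the vector with ⟪a, z⟫ = tr(P ∘ ad z). Then ā = -a, so A = i a is real. For x in 𝔮, ⟪x, [a,
x]⟫ = tr(P [ad x, (ad x)*]) is the squared Hilbert–Schmidt norm of P ∘ ad x ∘ (1 - P)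
(`trace_proj_commutator_adjoint`). So ad a has non-negative eigenvalues on 𝔮, and an eigenvector x
of eigenvalue 0 has x̄ normalizing 𝔮. If 𝔮 is self-normalizing and contains its B-orthogonal, this
forces 𝔮 = 𝔮_A (`eq_iSup_eigenspace`). Since no choice was made, an isometric automorphism
preserving 𝔮 fixes A (`map_traceVector`); applied to Ad(g), g ∈ M₀, this gives A ∈ 𝔞₀(M₀).

The two properties hold for a Borel subalgebra by maximality, Lie's theorem and Cartan's criterion
(`mem_of_killingForm_eq_zero`), and then pass to every larger subalgebra.

Conversely, the positive eigenspaces of ad A together with A span a solvable subalgebra. A Borel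
subalgebra containing it cannot contain an eigenvector x with negative eigenvalue, because x̄ would
lie in it too and the Killing form would vanish on (x̄, x). So it lies in 𝔮_A
(`isParabolic_nonnegEigen`).

On the group side, the bracket of left-invariant fields has to be identified with the derivative of
Ad (`mfderiv_AdL_apply`); the invariance of the inner product under ad and the automorphism property
of Ad(g) follow by differentiating at the identity. -/

noncomputable section

namespace CRLie

/-! ### Hermitian linear algebra: the trace vector of a subspace. -/

section HermitianLie

variable {V : Type*} [NormedAddCommGroup V] [InnerProductSpace ℂ V] [FiniteDimensional ℂ V]

open LinearMap

/-- The trace of `P [T, T*]`, for `P` the orthogonal projection to a `T`-stable subspace. -/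
theorem trace_proj_commutator_adjoint (S : Submodule ℂ V) (T : V →ₗ[ℂ] V)
    (hT : ∀ x ∈ S, T x ∈ S) (P R : V →ₗ[ℂ] V) (hP : P = S.starProjection.toLinearMap)
    (hR : R = P * T * (1 - P)) :
    trace ℂ V (P * (T * adjoint T - adjoint T * T)) = trace ℂ V (R * adjoint R) := by
  have hPP : P * P = P := by
    ext x
    simpa [hP] using Submodule.starProjection_eq_self_iff.mpr (Submodule.starProjection_apply_mem S x)
  have hPs : adjoint P = P := by
    rw [hP]
    ext x
    refine ext_inner_right ℂ fun y => ?_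
    rw [adjoint_inner_left]
    simp [Submodule.inner_starProjection_left_eq_right]
  have hTP : T * P = P * T * P := by
    ext x
    simp only [Module.End.mul_apply, hP]
    exact (Submodule.starProjection_eq_self_iff.mpr (hT _ (Submodule.starProjection_apply_mem _ _))).symm
  have hPT : P * adjoint T = P * adjoint T * P := by
    have := congrArg adjoint hTP
    simpa [Module.End.mul_eq_comp, adjoint_comp, hPs, LinearMap.comp_assoc] using this
  have e1 : R * adjoint R = P * T * (1 - P) * adjoint T * P := by
    have : adjoint R = (1 - P) * adjoint T * P := by
      rw [hR]
      simp only [Module.End.mul_eq_comp, adjoint_comp, hPs, map_sub]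
      have : adjoint (1 : V →ₗ[ℂ] V) = 1 := by
        ext x; refine ext_inner_right ℂ fun y => ?_
        rw [adjoint_inner_left]; simp
      rw [this, LinearMap.comp_assoc]
    have h1 : (1 - P) * (1 - P) = 1 - P := by
      rw [mul_sub, sub_mul, sub_mul]; simp [hPP]
    rw [this, hR]
    calc _ = P * T * ((1 - P) * (1 - P)) * adjoint T * P := by noncomm_ring
      _ = _ := by rw [h1]
  -- As S is stable, P T P = T P; cyclicity then turns the second term into tr (P T* T), which is
  -- `e3`.
  have e2 : trace ℂ V (P * T * (1 - P) * adjoint T * P) =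
      trace ℂ V (P * T * adjoint T) - trace ℂ V (T * P * adjoint T) := by
    rw [trace_mul_comm]
    have : P * (P * T * (1 - P) * adjoint T) = P * T * adjoint T - T * P * adjoint T := by
      calc P * (P * T * (1 - P) * adjoint T) = (P * P) * T * adjoint T - (P * P) * T * P * adjoint T := by
            noncomm_ring
        _ = _ := by rw [hPP, hTP]
    rw [this, map_sub]
  have e3 : trace ℂ V (P * adjoint T * T) = trace ℂ V (T * P * adjoint T) := by
    rw [mul_assoc, trace_mul_comm, mul_assoc, trace_mul_comm]
  rw [e1, e2, ← e3, mul_sub, map_sub, mul_assoc, mul_assoc]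

/-- The trace of `P [A, B]` vanishes, for `P` the orthogonal projection to a stable subspace. -/
theorem trace_proj_commutator (S : Submodule ℂ V) (A B : V →ₗ[ℂ] V)
    (hA : ∀ x ∈ S, A x ∈ S) (hB : ∀ x ∈ S, B x ∈ S) :
    trace ℂ V (S.starProjection.toLinearMap * (A * B - B * A)) = 0 := by
  set P : V →ₗ[ℂ] V := S.starProjection.toLinearMap with hP
  have key : ∀ T : V →ₗ[ℂ] V, (∀ x ∈ S, T x ∈ S) → T * P = P * T * P := by
    intro T hT
    ext x
    simp only [Module.End.mul_apply, hP]
    exact (Submodule.starProjection_eq_self_iff.mpr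
      (hT _ (Submodule.starProjection_apply_mem _ _))).symm
  have e : ∀ A B : V →ₗ[ℂ] V, (∀ x ∈ S, B x ∈ S) →
      trace ℂ V (P * (A * B)) = trace ℂ V (A * P * B * P) := by
    intro A B hB
    rw [trace_mul_comm, mul_assoc, key B hB]
    simp only [mul_assoc]
  have e' : trace ℂ V (B * P * A * P) = trace ℂ V (A * P * B * P) := by
    rw [mul_assoc (B * P), trace_mul_comm]
    simp only [mul_assoc]
  rw [mul_sub, map_sub, e A B hB, e B A hA, e', sub_self]

/-- The trace is the squared Hilbert–Schmidt norm. Positivity will give the sign of the eigenvalues,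
and definiteness the case of eigenvalue zero. -/
theorem trace_mul_adjoint_self (R : V →ₗ[ℂ] V) :
    ∃ r : ℝ, 0 ≤ r ∧ trace ℂ V (R * adjoint R) = r ∧ (r = 0 → R = 0) := by
  have b := stdOrthonormalBasis ℂ V
  refine ⟨∑ i, ‖adjoint R (b i)‖ ^ 2, Finset.sum_nonneg fun i _ => by positivity, ?_, fun h => ?_⟩
  · rw [trace_eq_sum_inner _ b]
    push_cast
    refine Finset.sum_congr rfl fun i _ => ?_
    rw [Module.End.mul_apply, ← adjoint_inner_left, inner_self_eq_norm_sq_to_K]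
    rfl
  · rw [Finset.sum_eq_zero_iff_of_nonneg fun i _ => by positivity] at h
    have : adjoint R = 0 := b.toBasis.ext fun i => by simpa using h i (Finset.mem_univ _)
    rw [← adjoint_adjoint R, this, map_zero]

/-- An invariant subspace of a symmetric operator lies in any subspace that contains its
eigenvectors. -/
theorem le_of_forall_eigenvector {T : V →ₗ[ℂ] V} (hT : T.IsSymmetric) {S S' : Submodule ℂ V}
    (hS : ∀ x ∈ S, T x ∈ S) (h : ∀ μ : ℝ, ∀ x ∈ S, T x = (μ : ℂ) • x → x ∈ S') : S ≤ S' := by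
  have hs := hT.restrict_invariant hS
  have htop := hs.orthogonalComplement_iSup_eigenspaces_eq_bot
  rw [Submodule.orthogonal_eq_bot_iff] at htop
  have key : (⨆ μ, Module.End.eigenspace (T.restrict hS) μ) ≤ S'.comap S.subtype := by
    refine iSup_le fun μ x hx => ?_
    by_cases hx0 : x = 0
    · simp [hx0]
    have hμ := hs.conj_eigenvalue_eq_self
      (Module.End.hasEigenvalue_of_hasEigenvector ⟨hx, hx0⟩)
    obtain ⟨r, rfl⟩ := Complex.conj_eq_iff_real.mp hμ
    refine h r x x.2 ?_
    simpa using congrArg Subtype.val (Module.End.mem_eigenspace_iff.mp hx)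
  intro x hx
  have : (⟨x, hx⟩ : S) ∈ (⊤ : Submodule ℂ S) := trivial
  rw [← htop] at this
  exact key this

local notation "⟪" x ", " y "⟫" => inner ℂ x y

/-- A Lie bracket `ad`, a conjugation `σ` of it, and a compatible Hermitian inner product: the
structure of the complexification of a compact Lie algebra. -/
structure IsCompactBracket (ad : V →ₗ[ℂ] V →ₗ[ℂ] V) (σ : V → V) : Prop where
  skew : ∀ x y, ad x y = -ad y x
  jacobi : ∀ x y, ad (ad x y) = ad x * ad y - ad y * ad x
  conj_conj : ∀ x, σ (σ x) = x
  conj_add : ∀ x y, σ (x + y) = σ x + σ y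
  conj_smul : ∀ (c : ℂ) x, σ (c • x) = (starRingEnd ℂ) c • σ x
  conj_inner : ∀ x y, ⟪σ x, σ y⟫ = ⟪y, x⟫
  conj_bracket : ∀ x y, σ (ad x y) = ad (σ x) (σ y)
  inner_bracket : ∀ x y z, ⟪ad x y, z⟫ = -⟪y, ad (σ x) z⟫

/-- The element representing the functional `Z ↦ tr (P ∘ ad Z)`, for `P` the orthogonal projection
to the subspace `S`. -/
def traceVector (ad : V →ₗ[ℂ] V →ₗ[ℂ] V) (S : Submodule ℂ V) : V :=
  (InnerProductSpace.toDual ℂ V).symm (LinearMap.toContinuousLinearMap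
    ((trace ℂ V ∘ₗ LinearMap.mulLeft ℂ (S.starProjection.toLinearMap : Module.End ℂ V)) ∘ₗ ad))

theorem inner_traceVector (ad : V →ₗ[ℂ] V →ₗ[ℂ] V) (S : Submodule ℂ V) (z : V) :
    ⟪traceVector ad S, z⟫ =
      trace ℂ V ((S.starProjection.toLinearMap : Module.End ℂ V) * (ad z : Module.End ℂ V)) := by
  simp [traceVector]

/-- The trace vector of a stable subspace is fixed by isometric automorphisms. -/
theorem map_traceVector (ad : V →ₗ[ℂ] V →ₗ[ℂ] V) (S : Submodule ℂ V) (u : V ≃ₗ[ℂ] V)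
    (hu : ∀ x y, ⟪u x, u y⟫ = ⟪x, y⟫) (hb : ∀ x y, u (ad x y) = ad (u x) (u y))
    (hS : S.map u.toLinearMap = S) : u (traceVector ad S) = traceVector ad S := by
  refine ext_inner_right ℂ fun z => ?_
  obtain ⟨z, rfl⟩ := u.surjective z
  rw [hu, inner_traceVector, inner_traceVector]
  -- A unitary map preserving S commutes with the projection, so both traces are those of conjugate
  -- operators.
  have hP : ∀ x, S.starProjection (u x) = u (S.starProjection x) := by
    intro x
    refine Submodule.eq_starProjection_of_mem_of_inner_eq_zero (K := S) ?_ ?_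
    · have : u (S.starProjection x) ∈ S.map u.toLinearMap :=
        ⟨_, Submodule.starProjection_apply_mem S x, rfl⟩
      rwa [hS] at this
    · intro w hw
      rw [← hS] at hw
      obtain ⟨w, hw, rfl⟩ := hw
      rw [← map_sub]
      exact (hu _ _).trans (Submodule.starProjection_inner_eq_zero x w hw)
  have : (S.starProjection.toLinearMap : Module.End ℂ V) * (ad (u z) : Module.End ℂ V) =
      u.conj (S.starProjection.toLinearMap * ad z : Module.End ℂ V) := by
    ext x
    obtain ⟨x, rfl⟩ := u.surjective x
    simp [LinearEquiv.conj_apply, ← hb, hP]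
  rw [this, trace_conj']

namespace IsCompactBracket

variable {ad : V →ₗ[ℂ] V →ₗ[ℂ] V} {σ : V → V} (h : IsCompactBracket ad σ)
include h

theorem adjoint_ad (x : V) : adjoint (ad x) = -ad (σ x) := by
  ext y
  refine ext_inner_left ℂ fun z => ?_
  rw [adjoint_inner_right, h.inner_bracket]
  simp

omit [FiniteDimensional ℂ V] in
theorem inner_conj_left (x y : V) : ⟪σ x, y⟫ = ⟪σ y, x⟫ := by
  rw [← h.conj_inner, h.conj_conj]

/-- P is self-adjoint and ad (σ z) = -(ad z)*, so replacing z by σ z negates and conjugates tr (P ad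
z). -/
theorem conj_traceVector (S : Submodule ℂ V) :
    σ (traceVector ad S) = -traceVector ad S := by
  refine ext_inner_right ℂ fun z => ?_
  have hP : adjoint (S.starProjection.toLinearMap : V →ₗ[ℂ] V) = S.starProjection.toLinearMap := by
    ext x
    refine ext_inner_right ℂ fun y => ?_
    rw [adjoint_inner_left]
    simp [Submodule.inner_starProjection_left_eq_right]
  have ht : ∀ T : V →ₗ[ℂ] V, trace ℂ V (adjoint T) = (starRingEnd ℂ) (trace ℂ V T) := by
    intro T
    simp [trace_eq_sum_inner _ (stdOrthonormalBasis ℂ V), adjoint_inner_right]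
  have hz : ad (σ z) = -adjoint (ad z) := by
    rw [h.adjoint_ad, neg_neg]
  rw [h.inner_conj_left, ← inner_conj_symm, inner_traceVector, inner_neg_left, inner_traceVector,
    ← ht, hz]
  simp only [Module.End.mul_eq_comp, adjoint_comp, hP, map_neg, adjoint_adjoint]
  rw [← Module.End.mul_eq_comp, ← Module.End.mul_eq_comp, neg_mul, map_neg, trace_mul_comm]

omit [FiniteDimensional ℂ V] in
theorem isSymmetric_ad {a : V} (ha : σ a = -a) : (ad a).IsSymmetric := by
  intro x y
  rw [h.inner_bracket, ha]
  simp

/-- Pairing the eigenvector equation with x gives μ ‖x‖² = ‖P ad x (1 - P)‖². If μ = 0, then ad x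
preserves Sᗮ, hence (ad x)* = -ad (σ x) preserves S. -/
theorem eigenvalue_nonneg (S : Submodule ℂ V) (hS : ∀ x ∈ S, ∀ y ∈ S, ad x y ∈ S)
    {x : V} (hx : x ∈ S) (hx0 : x ≠ 0) {μ : ℝ} (hμ : ad (traceVector ad S) x = (μ : ℂ) • x) :
    0 ≤ μ ∧ (μ = 0 → ∀ y ∈ S, ad (σ x) y ∈ S) := by
  obtain ⟨r, hr0, hr, hr1⟩ := trace_mul_adjoint_self
    ((S.starProjection.toLinearMap : Module.End ℂ V) * ad x * (1 - S.starProjection.toLinearMap))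
  have h1 : ⟪x, ad (traceVector ad S) x⟫ = (r : ℂ) := by
    rw [← hr, ← trace_proj_commutator_adjoint S (ad x) (hS x hx) _ _ rfl rfl, h.skew,
      inner_neg_right]
    have : -⟪x, ad x (traceVector ad S)⟫ = ⟪ad (σ x) x, traceVector ad S⟫ := by
      rw [h.inner_bracket, h.conj_conj]
    rw [this, ← inner_conj_symm, inner_traceVector, h.jacobi]
    have h2 : ad (σ x) = -adjoint (ad x) := by rw [h.adjoint_ad, neg_neg]
    have h3 : ad (σ x) * ad x - ad x * ad (σ x) =
        (ad x * adjoint (ad x) - adjoint (ad x) * ad x : Module.End ℂ V) := by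
      rw [h2]; noncomm_ring
    rw [h3, trace_proj_commutator_adjoint S (ad x) (hS x hx) _ _ rfl rfl, hr, Complex.conj_ofReal]
  have h4 : μ * ‖x‖ ^ 2 = r := by
    rw [hμ, inner_smul_right, inner_self_eq_norm_sq_to_K] at h1
    have h2 : (μ : ℂ) * (‖x‖ : ℂ) ^ 2 = (r : ℂ) := h1
    exact_mod_cast h2
  have hxn : 0 < ‖x‖ ^ 2 := by positivity
  refine ⟨?_, ?_⟩
  · by_contra hneg
    nlinarith
  · intro h0 y hy
    have hR := hr1 (by rw [← h4, h0, zero_mul])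
    rw [← Submodule.orthogonal_orthogonal S, Submodule.mem_orthogonal]
    intro w hw
    have h5 : ad (σ x) y = -adjoint (ad x) y := by simp [h.adjoint_ad]
    rw [h5, inner_neg_right, adjoint_inner_right]
    have h6 : S.starProjection (ad x w) = 0 := by
      have := congrArg (fun f : V →ₗ[ℂ] V => f w) hR
      simpa [(Submodule.starProjection_apply_eq_zero_iff S).mpr hw] using this
    rw [(Submodule.starProjection_apply_eq_zero_iff S)] at h6
    rw [Submodule.inner_left_of_mem_orthogonal hy h6, neg_zero]

/-- A subspace that contains its opposite and is self-normalizing is the span of the nonnegative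
eigenspaces of its trace vector. -/
theorem eq_iSup_eigenspace (S : Submodule ℂ V) (hS : ∀ x ∈ S, ∀ y ∈ S, ad x y ∈ S)
    (hperp : ∀ x, (∀ y ∈ S, ⟪σ y, x⟫ = 0) → x ∈ S)
    (hnorm : ∀ x, (∀ y ∈ S, ad x y ∈ S) → x ∈ S) :
    S = ⨆ l : {x : ℝ // 0 ≤ x},
      Module.End.eigenspace (ad (traceVector ad S)) ((l : ℝ) : ℂ) := by
  set a := traceVector ad S with ha
  have hσa : σ a = -a := h.conj_traceVector S
  have hsymm := h.isSymmetric_ad hσa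
  -- In fact [a, S] is orthogonal to σ S: its pairings are traces tr (P [ad y, ad w]) with y, w in
  -- S, and these vanish. So a normalizes S.
  have haS : a ∈ S := by
    refine hnorm a fun y hy => hperp _ fun w hw => ?_
    have h1 : ⟪σ w, ad a y⟫ = ⟪ad (σ y) (σ w), a⟫ := by
      rw [h.inner_bracket, h.conj_conj, h.skew a y, inner_neg_right]
    rw [h1, ← h.conj_bracket, h.inner_conj_left, hσa, inner_neg_left, ha, inner_traceVector,
      h.jacobi, trace_proj_commutator S _ _ (hS y hy) (hS w hw), neg_zero]
  apply le_antisymm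
  · refine le_of_forall_eigenvector hsymm (hS a haS) fun μ x hx hμ => ?_
    by_cases hx0 : x = 0
    · rw [hx0]; exact zero_mem _
    exact Submodule.mem_iSup_of_mem ⟨μ, (h.eigenvalue_nonneg S hS hx hx0 hμ).1⟩
      (Module.End.mem_eigenspace_iff.mpr hμ)
  · refine iSup_le fun l x hx => ?_
    rw [Module.End.mem_eigenspace_iff] at hx
    set y := S.starProjection x
    have hy : y ∈ S := Submodule.starProjection_apply_mem S x
    have hw : x - y ∈ Sᗮ := Submodule.sub_starProjection_mem_orthogonal x
    set w := x - y with hwdef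
    have haw : ad a w ∈ Sᗮ := by
      rw [Submodule.mem_orthogonal]
      intro u hu
      rw [← hsymm]
      exact Submodule.inner_right_of_mem_orthogonal (hS a haS u hu) hw
    -- ad a preserves both S and Sᗮ, so each component of x satisfies the eigenvector equation.
    have hl : ad a w - ((l : ℝ) : ℂ) • w = 0 := by
      have h1 : ad a w - ((l : ℝ) : ℂ) • w ∈ Sᗮ := sub_mem haw (Submodule.smul_mem _ _ hw)
      have h2 : ad a w - ((l : ℝ) : ℂ) • w = -(ad a y - ((l : ℝ) : ℂ) • y) := by
        rw [hwdef, map_sub, hx, smul_sub]; abel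
      have h3 : ad a w - ((l : ℝ) : ℂ) • w ∈ S := by
        rw [h2]
        exact neg_mem (sub_mem (hS a haS y hy) (Submodule.smul_mem _ _ hy))
      exact inner_self_eq_zero.mp (Submodule.inner_right_of_mem_orthogonal h3 h1)
    have hσw : σ w ∈ S := hperp _ fun u hu => by
      rw [h.conj_inner]
      exact Submodule.inner_left_of_mem_orthogonal hu hw
    -- σ w lies in S with eigenvalue -l, so non-negativity forces l = 0. The zero case then puts w
    -- itself in S, while w is orthogonal to S.
    have hw0 : w = 0 := by
      by_contra hw0
      have hσw0 : σ w ≠ 0 := by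
        intro h0
        apply hw0
        rw [← h.conj_conj w, h0]
        simpa using h.conj_smul 0 0
      have hev : ad a (σ w) = ((-(l : ℝ) : ℝ) : ℂ) • σ w := by
        have : a = -σ a := by rw [hσa, neg_neg]
        rw [this, map_neg, LinearMap.neg_apply, ← h.conj_bracket, sub_eq_zero.mp hl, h.conj_smul]
        simp
      obtain ⟨h1, h2⟩ := h.eigenvalue_nonneg S hS hσw hσw0 hev
      have hl0 : (l : ℝ) = 0 := le_antisymm (by linarith) l.2
      have h3 := hnorm _ (h2 (by rw [hl0, neg_zero]))
      rw [h.conj_conj] at h3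
      exact hw0 (inner_self_eq_zero.mp (Submodule.inner_right_of_mem_orthogonal h3 hw))
    rw [sub_eq_zero.mp hw0]
    exact hy

end IsCompactBracket
end HermitianLie

/-! ### Solvable and Borel subalgebras: Lie's theorem and Cartan's criterion. -/

section Solvable

variable {𝔨 : Type*} [LieRing 𝔨] [LieAlgebra ℂ 𝔨]

open LieAlgebra LieModule

theorem isSolvable_of_isSolvable_derivedSeries_one {L : Type*} [LieRing L] [LieAlgebra ℂ L]
    (h : LieAlgebra.IsSolvable (derivedSeries ℂ L 1)) : LieAlgebra.IsSolvable L := by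
  obtain ⟨k, hk⟩ := IsSolvable.solvable ℂ (derivedSeries ℂ L 1)
  rw [LieIdeal.derivedSeries_eq_bot_iff] at hk
  refine IsSolvable.mk (R := ℂ) (k := k + 1) ?_
  rw [derivedSeries_def, derivedSeriesOfIdeal_add]
  exact hk

theorem mem_derivedSeries_one_induction {L : Type*} [LieRing L] [LieAlgebra ℂ L]
    (p : Submodule ℂ L) (hp : ∀ x y : L, ⁅x, y⁆ ∈ p) {x : L} (hx : x ∈ derivedSeries ℂ L 1) :
    x ∈ p := by
  have h1 : (derivedSeries ℂ L 1).toSubmodule ≤ p := by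
    have := coe_derivedSeries_one_eq ℂ L
    rw [LieIdeal.toLieSubalgebra_toSubmodule] at this
    rw [this, Submodule.span_le]
    rintro _ ⟨a, b, rfl⟩
    exact hp a b
  exact h1 hx

/-- A subalgebra whose brackets lie in a solvable subalgebra is solvable. -/
theorem isSolvable_of_lie_mem {𝔰 𝔱 : LieSubalgebra ℂ 𝔨} (h𝔰 : LieAlgebra.IsSolvable 𝔰)
    (h : ∀ x ∈ 𝔱, ∀ y ∈ 𝔱, ⁅x, y⁆ ∈ 𝔰) : LieAlgebra.IsSolvable 𝔱 := by
  have hle : ∀ x ∈ derivedSeries ℂ 𝔱 1, (x : 𝔨) ∈ 𝔰 := fun x hx =>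
    mem_derivedSeries_one_induction (L := 𝔱) (𝔰.toSubmodule.comap 𝔱.toSubmodule.subtype)
      (fun a b => h a a.2 b b.2) hx
  apply isSolvable_of_isSolvable_derivedSeries_one
  let f : derivedSeries ℂ 𝔱 1 →ₗ⁅ℂ⁆ 𝔰 :=
    { toFun := fun x => ⟨x.1.1, hle x.1 x.2⟩
      map_add' := fun _ _ => rfl
      map_smul' := fun _ _ => rfl
      map_lie' := rfl }
  refine Function.Injective.lieAlgebra_isSolvable (f := f) fun a b hab => ?_
  exact Subtype.ext (Subtype.ext (congrArg (fun z : 𝔰 => (z : 𝔨)) hab))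

/-- Lie's theorem gives a common eigenvector v, which ⁅x, y⁆ kills because x and y act on it by
scalars. Induction on the dimension applies to M modulo the line of v. Taking traces gives the easy
half of Cartan's criterion. -/
theorem isNilpotent_toEnd_mul_lie {L : Type*} [LieRing L] [LieAlgebra ℂ L]
    [LieAlgebra.IsSolvable L] (x y z : L) (n : ℕ) :
    ∀ (M : Type _) [AddCommGroup M] [Module ℂ M] [LieRingModule L M] [LieModule ℂ L M]
      [FiniteDimensional ℂ M], Module.finrank ℂ M = n →
      IsNilpotent (toEnd ℂ L M z * toEnd ℂ L M ⁅x, y⁆) := by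
  induction n using Nat.strong_induction_on with
  | _ n ih =>
  intro M _ _ _ _ _ hM
  rcases subsingleton_or_nontrivial M with hs | hn
  · exact ⟨1, LinearMap.ext fun v => Subsingleton.elim _ _⟩
  obtain ⟨χ, hχ⟩ := exists_nontrivial_weightSpace_of_isSolvable ℂ L M
  obtain ⟨⟨v, hv⟩, hv0⟩ := exists_ne (0 : weightSpace M χ)
  rw [mem_weightSpace] at hv
  have hv0' : v ≠ 0 := fun h => hv0 (Subtype.ext h)
  let N : LieSubmodule ℂ L M :=
    { Submodule.span ℂ {v} with
      lie_mem := by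
        intro w m hm
        obtain ⟨c, rfl⟩ := Submodule.mem_span_singleton.mp hm
        rw [lie_smul, hv]
        exact Submodule.smul_mem _ _ (Submodule.smul_mem _ _ (Submodule.mem_span_singleton_self v)) }
  have hN : N.toSubmodule = Submodule.span ℂ {v} := rfl
  have hlt : Module.finrank ℂ (M ⧸ N) < n := by
    rw [← hM]
    have h1 := N.toSubmodule.finrank_quotient_add_finrank
    rw [hN, finrank_span_singleton hv0'] at h1
    have h2 : Module.finrank ℂ (M ⧸ N) = Module.finrank ℂ (M ⧸ Submodule.span ℂ {v}) := rfl
    lia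
  obtain ⟨k, hk⟩ := ih _ hlt (M ⧸ N) rfl
  have hcomm : ∀ (j : ℕ) (m : M), (LieSubmodule.Quotient.mk
      (((toEnd ℂ L M z * toEnd ℂ L M ⁅x, y⁆) ^ j) m) : M ⧸ N) =
      ((toEnd ℂ L (M ⧸ N) z * toEnd ℂ L (M ⧸ N) ⁅x, y⁆) ^ j) (LieSubmodule.Quotient.mk m) := by
    intro j
    induction j with
    | zero => intro m; rfl
    | succ j ihj =>
      intro m
      rw [pow_succ, pow_succ, Module.End.mul_apply, Module.End.mul_apply, ihj]
      rfl
  refine ⟨k + 1, LinearMap.ext fun m => ?_⟩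
  have h1 : (LieSubmodule.Quotient.mk
      (((toEnd ℂ L M z * toEnd ℂ L M ⁅x, y⁆) ^ k) m) : M ⧸ N) = 0 := by
    rw [hcomm, hk]; rfl
  rw [LieSubmodule.Quotient.mk_eq_zero'] at h1
  obtain ⟨c, hc⟩ := Submodule.mem_span_singleton.mp (show _ ∈ Submodule.span ℂ {v} from h1)
  rw [pow_succ', Module.End.mul_apply, ← hc]
  have h2 : ⁅⁅x, y⁆, v⁆ = 0 := by
    rw [lie_lie, hv, hv, lie_smul, lie_smul, hv, hv, smul_comm, sub_self]
  have h3 : (toEnd ℂ L M z * toEnd ℂ L M ⁅x, y⁆) (c • v) = c • ⁅z, ⁅⁅x, y⁆, v⁆⁆ := by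
    rw [map_smul]; rfl
  rw [h3, h2, lie_zero, smul_zero, LinearMap.zero_apply]

theorem trace_ad_mul_ad_lie [FiniteDimensional ℂ 𝔨] {𝔰 : LieSubalgebra ℂ 𝔨}
    (h𝔰 : LieAlgebra.IsSolvable 𝔰) {x y z : 𝔨} (hx : x ∈ 𝔰) (hy : y ∈ 𝔰) (hz : z ∈ 𝔰) :
    killingForm ℂ 𝔨 z ⁅x, y⁆ = 0 := by
  have := isNilpotent_toEnd_mul_lie (⟨x, hx⟩ : 𝔰) ⟨y, hy⟩ ⟨z, hz⟩ _ 𝔨 rfl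
  exact (LinearMap.isNilpotent_trace_of_isNilpotent this).eq_zero

/-- Cartan's criterion for a subalgebra and the Killing form of the ambient algebra. -/
theorem isSolvable_of_killingForm_lie_eq_zero [FiniteDimensional ℂ 𝔨] {𝔰 : LieSubalgebra ℂ 𝔨}
    (h : ∀ x ∈ 𝔰, ∀ y ∈ 𝔰, ∀ z ∈ 𝔰, killingForm ℂ 𝔨 z ⁅x, y⁆ = 0) : LieAlgebra.IsSolvable 𝔰 := by
  apply isSolvable_of_isSolvable_derivedSeries_one
  have tf : traceForm ℂ (derivedSeries ℂ 𝔰 1) 𝔨 = 0 := by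
    ext ⟨x, hx⟩ ⟨y, hy⟩
    exact mem_derivedSeries_one_induction (L := 𝔰)
      ((LinearMap.ker (killingForm ℂ 𝔨 x.1)).comap 𝔰.toSubmodule.subtype)
      (fun a b => h a a.2 b b.2 x x.2) hy
  have hnil := LieModule.isNilpotent_derivedSeries_of_traceForm_eq_zero tf
  apply isSolvable_of_isSolvable_derivedSeries_one
  -- By `hnil`, 𝔨 is a nilpotent module over the second derived algebra; the adjoint module of that
  -- algebra embeds in 𝔨 and is therefore nilpotent.
  let f : derivedSeries ℂ (derivedSeries ℂ 𝔰 1) 1 →ₗ⁅ℂ⁆ derivedSeries ℂ (derivedSeries ℂ 𝔰 1) 1 :=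
    LieHom.id
  let g : derivedSeries ℂ (derivedSeries ℂ 𝔰 1) 1 →ₗ[ℂ] 𝔨 :=
    { toFun := fun x => x.1.1.1
      map_add' := fun _ _ => rfl
      map_smul' := fun _ _ => rfl }
  have hg : Function.Injective g := fun a b hab => Subtype.ext (Subtype.ext (Subtype.ext hab))
  have : LieRing.IsNilpotent (derivedSeries ℂ (derivedSeries ℂ 𝔰 1) 1) :=
    Function.Injective.lieModuleIsNilpotent (R := ℂ) (f := f) (g := g) (fun _ _ => rfl) hg
  infer_instance

/-- The subalgebra `𝔟 + ℂ x`, for `x` an eigenvector of `𝔟` modulo `𝔟`. -/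
def adjoin (𝔟 : LieSubalgebra ℂ 𝔨) (x : 𝔨) (hx : ∀ b ∈ 𝔟, ∃ c : ℂ, ⁅b, x⁆ - c • x ∈ 𝔟) :
    LieSubalgebra ℂ 𝔨 :=
  { 𝔟.toSubmodule ⊔ Submodule.span ℂ {x} with
    lie_mem' := by
      intro u v hu hv
      obtain ⟨b, hb, _, hc, rfl⟩ := Submodule.mem_sup.mp hu
      obtain ⟨b', hb', _, hc', rfl⟩ := Submodule.mem_sup.mp hv
      obtain ⟨c, rfl⟩ := Submodule.mem_span_singleton.mp hc
      obtain ⟨c', rfl⟩ := Submodule.mem_span_singleton.mp hc'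
      obtain ⟨d, hd⟩ := hx b hb
      obtain ⟨d', hd'⟩ := hx b' hb'
      refine Submodule.mem_sup.mpr ⟨⁅b, b'⁆ + c' • (⁅b, x⁆ - d • x) - c • (⁅b', x⁆ - d' • x),
        sub_mem (add_mem (𝔟.lie_mem hb hb') (𝔟.smul_mem _ hd)) (𝔟.smul_mem _ hd'),
        (c' * d - c * d') • x, Submodule.smul_mem _ _ (Submodule.mem_span_singleton_self x), ?_⟩
      rw [add_lie, lie_add, lie_add, smul_lie, smul_lie, lie_smul, lie_smul, lie_self,
        ← lie_skew x b']
      module }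

theorem mem_adjoin {𝔟 : LieSubalgebra ℂ 𝔨} {x : 𝔨}
    {hx : ∀ b ∈ 𝔟, ∃ c : ℂ, ⁅b, x⁆ - c • x ∈ 𝔟} {y : 𝔨} :
    y ∈ adjoin 𝔟 x hx ↔ ∃ b ∈ 𝔟, ∃ c : ℂ, b + c • x = y := by
  change y ∈ 𝔟.toSubmodule ⊔ Submodule.span ℂ {x} ↔ _
  simp [Submodule.mem_sup, Submodule.mem_span_singleton]

theorem isSolvable_adjoin {𝔟 : LieSubalgebra ℂ 𝔨} (h𝔟 : LieAlgebra.IsSolvable 𝔟) {x : 𝔨}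
    (hx : ∀ b ∈ 𝔟, ⁅b, x⁆ ∈ 𝔟) :
    LieAlgebra.IsSolvable (adjoin 𝔟 x fun b hb => ⟨0, by simpa using hx b hb⟩) := by
  refine isSolvable_of_lie_mem h𝔟 ?_
  intro u hu v hv
  obtain ⟨b, hb, c, rfl⟩ := mem_adjoin.mp hu
  obtain ⟨b', hb', c', rfl⟩ := mem_adjoin.mp hv
  rw [add_lie, lie_add, lie_add, smul_lie, smul_lie, lie_smul, lie_smul, lie_self,
    ← lie_skew x b', smul_zero, smul_zero, add_zero]
  exact add_mem (add_mem (𝔟.lie_mem hb hb') (𝔟.smul_mem _ (hx b hb)))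
    (𝔟.smul_mem _ (neg_mem (hx b' hb')))

theorem exists_isBorel_ge [FiniteDimensional ℂ 𝔨] {𝔰 : LieSubalgebra ℂ 𝔨}
    (h𝔰 : LieAlgebra.IsSolvable 𝔰) : ∃ 𝔟, IsBorel 𝔟 ∧ 𝔰 ≤ 𝔟 := by
  obtain ⟨𝔟, h1, h2⟩ := exists_maximal_ge_of_wellFoundedGT
    (fun 𝔰 : LieSubalgebra ℂ 𝔨 => LieAlgebra.IsSolvable 𝔰) 𝔰 h𝔰
  exact ⟨𝔟, h2, h1⟩

namespace IsBorel

variable {𝔟 : LieSubalgebra ℂ 𝔨} (h : IsBorel 𝔟)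
include h

theorem mem_of_isSolvable_adjoin {x : 𝔨} (hx : ∀ b ∈ 𝔟, ∃ c : ℂ, ⁅b, x⁆ - c • x ∈ 𝔟)
    (hs : LieAlgebra.IsSolvable (adjoin 𝔟 x hx)) : x ∈ 𝔟 :=
  h.le_of_ge hs (fun b hb => mem_adjoin.mpr ⟨b, hb, 0, by simp⟩)
    (mem_adjoin.mpr ⟨0, zero_mem _, 1, by simp⟩)

/-- A Borel subalgebra is self-normalizing. -/
theorem mem_of_lie_mem {x : 𝔨} (hx : ∀ b ∈ 𝔟, ⁅b, x⁆ ∈ 𝔟) : x ∈ 𝔟 :=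
  h.mem_of_isSolvable_adjoin _ (isSolvable_adjoin h.prop hx)

/-- A Borel subalgebra contains its orthogonal for the Killing form. -/
theorem mem_of_killingForm_eq_zero [FiniteDimensional ℂ 𝔨] {x : 𝔨}
    (hx : ∀ b ∈ 𝔟, killingForm ℂ 𝔨 b x = 0) : x ∈ 𝔟 := by
  by_contra hxb
  have := h.prop
  let 𝔭 : LieSubmodule ℂ 𝔟 𝔨 :=
    { carrier := {x | ∀ b ∈ 𝔟, killingForm ℂ 𝔨 b x = 0}
      add_mem' := fun ha hb c hc => by rw [map_add, ha c hc, hb c hc, add_zero]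
      zero_mem' := fun c _ => map_zero _
      smul_mem' := fun r a ha c hc => by rw [map_smul, ha c hc, smul_zero]
      lie_mem := fun {b m} hm c hc => by
        have := LieModule.traceForm_apply_lie_apply ℂ 𝔨 𝔨 c b m
        exact this.symm.trans (hm _ (𝔟.lie_mem hc b.2)) }
  have hbM : ∀ y, y ∈ 𝔟.toLieSubmodule ↔ y ∈ 𝔟 := fun y => Iff.rfl
  -- If the orthogonal 𝔭 were not inside 𝔟, its image in 𝔨 ⧸ 𝔟 would be nonzero, and Lie's theorem
  -- would give z ∈ 𝔭 outside 𝔟 that is an eigenvector modulo 𝔟.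
  let W : LieSubmodule ℂ 𝔟 (𝔨 ⧸ 𝔟.toLieSubmodule) := 𝔭.map (LieSubmodule.Quotient.mk' _)
  have hW : Nontrivial W := by
    refine ⟨⟨⟨LieSubmodule.Quotient.mk x, LieSubmodule.mem_map_of_mem hx⟩, 0, fun h0 => hxb ?_⟩⟩
    have := congrArg Subtype.val h0
    exact (LieSubmodule.Quotient.mk_eq_zero').mp this
  obtain ⟨χ, hχ⟩ := exists_nontrivial_weightSpace_of_isSolvable ℂ 𝔟 W
  obtain ⟨⟨⟨w, hw⟩, hwχ⟩, hw0⟩ := exists_ne (0 : weightSpace W χ)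
  rw [mem_weightSpace] at hwχ
  obtain ⟨z, hz, rfl⟩ := (LieSubmodule.mem_map _).mp hw
  have hzb : z ∉ 𝔟 := fun hzb => hw0 (Subtype.ext (Subtype.ext
    (LieSubmodule.Quotient.mk_eq_zero'.mpr hzb)))
  have hzχ : ∀ b : 𝔟, ⁅(b : 𝔨), z⁆ - χ b • z ∈ 𝔟 := by
    intro b
    have h1 := congrArg Subtype.val (hwχ b)
    exact (Submodule.Quotient.eq _).mp h1
  have hz' : ∀ b ∈ 𝔟, ∃ c : ℂ, ⁅b, z⁆ - c • z ∈ 𝔟 := fun b hb => ⟨_, hzχ ⟨b, hb⟩⟩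
  by_cases hχ0 : ∀ b, χ b = 0
  · exact hzb (h.mem_of_lie_mem fun b hb => by simpa [hχ0] using hzχ ⟨b, hb⟩)
  push Not at hχ0
  obtain ⟨b₀, hb₀⟩ := hχ0
  have hp : ∀ b ∈ 𝔟, ∀ y, y ∈ 𝔭 → killingForm ℂ 𝔨 b y = 0 := fun b hb y hy => hy b hb
  have hzp : ∀ b : 𝔟, ⁅(b : 𝔨), z⁆ - χ b • z ∈ 𝔭 :=
    fun b => sub_mem (𝔭.lie_mem hz) (𝔭.smul_mem _ hz)
  have hcomm : ∀ u v, killingForm ℂ 𝔨 u v = killingForm ℂ 𝔨 v u := LieModule.traceForm_comm ℂ 𝔨 𝔨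
  -- Invariance kills κ(z, [b₀, z]), and z is orthogonal to [b₀, z] - χ(b₀) z ∈ 𝔟; hence χ(b₀) κ(z,
  -- z) = 0.
  have hzz : killingForm ℂ 𝔨 z z = 0 := by
    have h1 : killingForm ℂ 𝔨 z ⁅(b₀ : 𝔨), z⁆ = 0 := by
      rw [hcomm]
      exact (LieModule.traceForm_apply_lie_apply ℂ 𝔨 𝔨 b₀ z z).trans (by rw [lie_self, map_zero])
    have h2 : killingForm ℂ 𝔨 z (⁅(b₀ : 𝔨), z⁆ - χ b₀ • z) = 0 := by
      rw [hcomm]; exact hp _ (hzχ b₀) z hz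
    rw [map_sub, h1, map_smul, zero_sub, neg_eq_zero, smul_eq_mul] at h2
    exact (mul_eq_zero.mp h2).resolve_left hb₀
  -- As z is isotropic and orthogonal to 𝔟, the Killing form on 𝔟 + ℂ z only sees 𝔟, and Cartan's
  -- criterion for 𝔟 carries over. This contradicts maximality.
  refine hzb (h.mem_of_isSolvable_adjoin hz' (isSolvable_of_killingForm_lie_eq_zero ?_))
  intro u hu v hv t ht
  obtain ⟨b₁, hb₁, c₁, rfl⟩ := mem_adjoin.mp hu
  obtain ⟨b₂, hb₂, c₂, rfl⟩ := mem_adjoin.mp hv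
  obtain ⟨b, hb, c, rfl⟩ := mem_adjoin.mp ht
  have hbz : ∀ a ∈ 𝔟, killingForm ℂ 𝔨 z a = 0 := fun a ha => (hcomm _ _).trans (hp a ha z hz)
  have hk1 : ∀ a (ha : a ∈ 𝔟), killingForm ℂ 𝔨 (b + c • z) ⁅a, z⁆ = 0 := by
    intro a ha
    have : ⁅a, z⁆ = (⁅a, z⁆ - χ ⟨a, ha⟩ • z) + χ ⟨a, ha⟩ • z := by abel
    rw [this, map_add, map_add, map_smul, map_smul, LinearMap.add_apply, LinearMap.add_apply,
      LinearMap.smul_apply, LinearMap.smul_apply, hp b hb _ (hzp ⟨a, ha⟩),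
      hbz _ (hzχ ⟨a, ha⟩), hzz, hp b hb z hz]
    simp
  have hk2 : killingForm ℂ 𝔨 (b + c • z) ⁅b₁, b₂⁆ = 0 := by
    rw [map_add, map_smul, LinearMap.add_apply, LinearMap.smul_apply,
      trace_ad_mul_ad_lie h.prop hb₁ hb₂ hb, hbz _ (𝔟.lie_mem hb₁ hb₂)]
    simp
  rw [add_lie, lie_add, lie_add, smul_lie, smul_lie, lie_smul, lie_smul, lie_self,
    ← lie_skew z b₂, smul_zero, smul_zero, add_zero, map_add, map_add, map_smul, map_smul,
    map_neg, hk1 b₁ hb₁, hk1 b₂ hb₂, hk2]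
  simp

end IsBorel

end Solvable

/-! ### Parabolic subalgebras of a complex Lie algebra with a compact real form. -/

section CompactConjugation

variable {𝔨 : Type*} [LieRing 𝔨] [LieAlgebra ℂ 𝔨]

/-- The conjugation `σ` of a complex Lie algebra with respect to a compact real form, with an
invariant symmetric form `B` that is positive on the real form and agrees with the opposite of the
Killing form up to a term carried by the center. -/
structure IsCompactConj (σ : 𝔨 → 𝔨) (B : LinearMap.BilinForm ℂ 𝔨) : Prop where
  conj_conj : ∀ x, σ (σ x) = x
  conj_add : ∀ x y, σ (x + y) = σ x + σ y
  conj_smul : ∀ (c : ℂ) x, σ (c • x) = (starRingEnd ℂ) c • σ x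
  conj_lie : ∀ x y : 𝔨, σ ⁅x, y⁆ = ⁅σ x, σ y⁆
  form_conj : ∀ x y, B (σ x) (σ y) = (starRingEnd ℂ) (B x y)
  form_symm : ∀ x y, B x y = B y x
  form_nonneg : ∀ x, 0 ≤ (B (σ x) x).re
  form_definite : ∀ x, B (σ x) x = 0 → x = 0
  form_lie : ∀ x y z : 𝔨, B ⁅x, y⁆ z = -B y ⁅x, z⁆
  center : ∃ π : 𝔨 → 𝔨, (∀ x y : 𝔨, ⁅π x, y⁆ = 0) ∧
    ∀ x y, B x y = -killingForm ℂ 𝔨 x y + B (π x) y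

/-- The span of the eigenspaces of `ad a` with eigenvalue `i l`, `l ≥ t`. -/
def eigenGeSubmodule (a : 𝔨) (t : ℝ) : Submodule ℂ 𝔨 :=
  ⨆ l : {x : ℝ // t ≤ x}, Module.End.eigenspace (LieAlgebra.ad ℂ 𝔨 a) (Complex.I * ((l : ℝ) : ℂ))

theorem eigenGeSubmodule_anti (a : 𝔨) {s t : ℝ} (h : s ≤ t) :
    eigenGeSubmodule a t ≤ eigenGeSubmodule a s :=
  iSup_le fun l => le_iSup (fun l : {x : ℝ // s ≤ x} =>
    Module.End.eigenspace (LieAlgebra.ad ℂ 𝔨 a) (Complex.I * ((l : ℝ) : ℂ))) ⟨l, h.trans l.2⟩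

theorem mem_eigenGeSubmodule {a x : 𝔨} {s t : ℝ} (hst : s ≤ t)
    (hx : ⁅a, x⁆ = (Complex.I * (t : ℂ)) • x) : x ∈ eigenGeSubmodule a s :=
  Submodule.mem_iSup_of_mem ⟨t, hst⟩ (Module.End.mem_eigenspace_iff.mpr hx)

theorem lie_mem_eigenGeSubmodule (a : 𝔨) {s t : ℝ} {x y : 𝔨} (hx : x ∈ eigenGeSubmodule a s)
    (hy : y ∈ eigenGeSubmodule a t) : ⁅x, y⁆ ∈ eigenGeSubmodule a (s + t) := by
  refine Submodule.iSup_induction _ (motive := fun x => ⁅x, y⁆ ∈ eigenGeSubmodule a (s + t)) hx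
    (fun l x hx => ?_) (by simp) (fun x x' h h' => by rw [add_lie]; exact add_mem h h')
  refine Submodule.iSup_induction _ (motive := fun y => ⁅x, y⁆ ∈ eigenGeSubmodule a (s + t)) hy
    (fun m y hy => ?_) (by simp) (fun y y' h h' => by rw [lie_add]; exact add_mem h h')
  rw [Module.End.mem_eigenspace_iff, LieAlgebra.ad_apply] at hx hy
  refine mem_eigenGeSubmodule (add_le_add l.2 m.2) ?_
  rw [leibniz_lie, hx, hy, smul_lie, lie_smul, ← add_smul, Complex.ofReal_add, mul_add]

theorem self_lie_mem_eigenGeSubmodule (a : 𝔨) {t : ℝ} {x : 𝔨} (hx : x ∈ eigenGeSubmodule a t) :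
    ⁅a, x⁆ ∈ eigenGeSubmodule a t := by
  have ha : a ∈ eigenGeSubmodule a 0 := mem_eigenGeSubmodule (t := 0) le_rfl (by simp)
  simpa using lie_mem_eigenGeSubmodule a ha hx

/-- The same span as a Lie subalgebra. -/
def eigenGe (a : 𝔨) (t : ℝ) (ht : 0 ≤ t) : LieSubalgebra ℂ 𝔨 :=
  { eigenGeSubmodule a t with
    lie_mem' := fun hx hy =>
      eigenGeSubmodule_anti a (by linarith) (lie_mem_eigenGeSubmodule a hx hy) }

/-- With δ below every positive eigenvalue, `eigenGe a δ` contains all positive eigenspaces; the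
bound M makes the filtration by eigenvalue terminate. -/
theorem exists_pos_le_eigenvalue [FiniteDimensional ℂ 𝔨] (a : 𝔨) :
    ∃ δ M : ℝ, 0 < δ ∧ ∀ (μ : ℝ) (x : 𝔨), 0 < μ → ⁅a, x⁆ = (Complex.I * μ) • x → x ≠ 0 →
      δ ≤ μ ∧ μ ≤ M := by
  have hfin : {μ : ℝ | 0 < μ ∧ Module.End.HasEigenvalue (LieAlgebra.ad ℂ 𝔨 a) (Complex.I * μ)}.Finite := by
    refine Set.Finite.subset (Set.Finite.preimage (f := fun μ : ℝ => Complex.I * (μ : ℂ)) ?_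
      (Module.End.finite_hasEigenvalue (LieAlgebra.ad ℂ 𝔨 a))) fun μ hμ => hμ.2
    intro x _ y _ hxy
    exact_mod_cast mul_left_cancel₀ Complex.I_ne_zero hxy
  obtain ⟨M, hM⟩ := hfin.bddAbove
  have hev : ∀ (μ : ℝ) (x : 𝔨), ⁅a, x⁆ = (Complex.I * μ) • x → x ≠ 0 →
      Module.End.HasEigenvalue (LieAlgebra.ad ℂ 𝔨 a) (Complex.I * μ) := fun μ x hx hx0 =>
    Module.End.hasEigenvalue_of_hasEigenvector ⟨Module.End.mem_eigenspace_iff.mpr hx, hx0⟩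
  rcases Set.eq_empty_or_nonempty
    {μ : ℝ | 0 < μ ∧ Module.End.HasEigenvalue (LieAlgebra.ad ℂ 𝔨 a) (Complex.I * μ)} with he | hne
  · refine ⟨1, 0, one_pos, fun μ x hμ hx hx0 => ?_⟩
    have : μ ∈ (∅ : Set ℝ) := he ▸ ⟨hμ, hev μ x hx hx0⟩
    exact this.elim
  · obtain ⟨δ, hδ, hδ'⟩ := Set.exists_min_image _ id hfin hne
    exact ⟨δ, M, hδ.1, fun μ x hμ hx hx0 =>
      ⟨hδ' μ ⟨hμ, hev μ x hx hx0⟩, hM ⟨hμ, hev μ x hx hx0⟩⟩⟩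

theorem isSolvable_eigenGe [FiniteDimensional ℂ 𝔨] (a : 𝔨) {δ M : ℝ} (hδ : 0 < δ)
    (hM : ∀ (μ : ℝ) (x : 𝔨), 0 < μ → ⁅a, x⁆ = (Complex.I * μ) • x → x ≠ 0 → μ ≤ M) :
    LieAlgebra.IsSolvable (eigenGe a δ hδ.le) := by
  -- Brackets raise the threshold from t to 2t ≥ t + δ, so k bounds the number of derived steps
  -- before passing M.
  have key : ∀ (k : ℕ) (t : ℝ) (ht : δ ≤ t), M < t + k * δ →
      LieAlgebra.IsSolvable (eigenGe a t (hδ.le.trans ht)) := by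
    intro k
    induction k with
    | zero =>
      intro t ht hMt
      have hbot : ∀ x ∈ eigenGeSubmodule a t, x = 0 := by
        have : eigenGeSubmodule a t ≤ ⊥ := iSup_le fun l x hx => by
          rw [Submodule.mem_bot]
          by_contra hx0
          have := hM l x (hδ.trans_le (ht.trans l.2)) (Module.End.mem_eigenspace_iff.mp hx) hx0
          have h2 := l.2
          simp only [Nat.cast_zero, zero_mul, add_zero] at hMt
          linarith
        exact fun x hx => (Submodule.mem_bot ℂ).mp (this hx)
      have : Subsingleton (eigenGe a t (hδ.le.trans ht)) :=
        ⟨fun x y => Subtype.ext ((hbot x x.2).trans (hbot y y.2).symm)⟩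
      exact LieAlgebra.IsSolvable.mk (R := ℂ) (k := 0) (Subsingleton.elim _ _)
    | succ k ih =>
      intro t ht hMt
      push_cast at hMt
      refine isSolvable_of_lie_mem (ih (t + δ) (by linarith) (by linarith)) fun x hx y hy => ?_
      exact eigenGeSubmodule_anti a (by linarith) (lie_mem_eigenGeSubmodule a hx hy)
  obtain ⟨k, hk⟩ := exists_nat_gt ((M - δ) / δ)
  refine key k δ le_rfl ?_
  rw [div_lt_iff₀ hδ] at hk
  linarith

namespace IsCompactConj

variable {σ : 𝔨 → 𝔨} {B : LinearMap.BilinForm ℂ 𝔨} (h : IsCompactConj σ B)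
include h

/-- The Hermitian inner product `⟪x, y⟫ = B (σ x) y`. -/
@[reducible]
def core : InnerProductSpace.Core ℂ 𝔨 where
  inner x y := B (σ x) y
  conj_inner_symm x y := by rw [← h.form_conj, h.conj_conj, h.form_symm]
  re_inner_nonneg := h.form_nonneg
  add_left x y z := by rw [h.conj_add, map_add, LinearMap.add_apply]
  smul_left x y r := by rw [h.conj_smul, map_smul, LinearMap.smul_apply, smul_eq_mul]
  definite := h.form_definite

theorem conj_zero : σ 0 = 0 := by simpa using h.conj_smul 0 0

theorem isCompactBracket :
    letI := h.core.toNormedAddCommGroup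
    letI := InnerProductSpace.ofCore h.core.toCore
    IsCompactBracket (V := 𝔨) (LieAlgebra.ad ℂ 𝔨 : 𝔨 →ₗ[ℂ] 𝔨 →ₗ[ℂ] 𝔨) σ := by
  have hj : ∀ x y : 𝔨, LieAlgebra.ad ℂ 𝔨 ⁅x, y⁆ =
      LieAlgebra.ad ℂ 𝔨 x * LieAlgebra.ad ℂ 𝔨 y - LieAlgebra.ad ℂ 𝔨 y * LieAlgebra.ad ℂ 𝔨 x :=
    fun x y => LinearMap.ext fun z => lie_lie x y z
  let _ := h.core.toNormedAddCommGroup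
  let _ := InnerProductSpace.ofCore h.core.toCore
  have hin : ∀ x y : 𝔨, inner ℂ x y = B (σ x) y := fun _ _ => rfl
  exact
    { skew := fun x y => (lie_skew x y).symm
      jacobi := hj
      conj_conj := h.conj_conj
      conj_add := h.conj_add
      conj_smul := h.conj_smul
      conj_inner := fun x y => by rw [hin, hin, h.conj_conj, h.form_symm]
      conj_bracket := h.conj_lie
      inner_bracket := fun x y z => by
        rw [hin, hin]
        exact (congrArg (fun w => B w z) (h.conj_lie x y)).trans (h.form_lie _ _ _) }

variable [FiniteDimensional ℂ 𝔨]

/-- A subalgebra that contains its orthogonal and is self-normalizing is the span of the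
nonnegative eigenspaces of an element of the real form, which is fixed by all the automorphisms
that preserve the subalgebra and the Hermitian product. -/
theorem exists_eq_nonnegEigen {𝔮 : LieSubalgebra ℂ 𝔨}
    (hperp : ∀ x, (∀ y ∈ 𝔮, B y x = 0) → x ∈ 𝔮)
    (hnorm : ∀ x, (∀ y ∈ 𝔮, ⁅x, y⁆ ∈ 𝔮) → x ∈ 𝔮) :
    ∃ a : 𝔨, σ a = a ∧ 𝔮 = nonnegEigen a ∧ ∀ u : 𝔨 ≃ₗ[ℂ] 𝔨, (∀ x y, u ⁅x, y⁆ = ⁅u x, u y⁆) →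
      (∀ x y, B (σ (u x)) (u y) = B (σ x) y) →
      𝔮.toSubmodule.map u.toLinearMap = 𝔮.toSubmodule → u a = a := by
  let _ := h.core.toNormedAddCommGroup
  let _ := InnerProductSpace.ofCore h.core.toCore
  have hin : ∀ x y : 𝔨, inner ℂ x y = B (σ x) y := fun _ _ => rfl
  have hc := h.isCompactBracket
  set ad' : 𝔨 →ₗ[ℂ] 𝔨 →ₗ[ℂ] 𝔨 := (LieAlgebra.ad ℂ 𝔨 : 𝔨 →ₗ[ℂ] 𝔨 →ₗ[ℂ] 𝔨) with had
  have key := hc.eq_iSup_eigenspace 𝔮.toSubmodule (fun x hx y hy => 𝔮.lie_mem hx hy)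
    (fun x hx => hperp x fun y hy => by
      have := hx y hy
      rwa [hin, h.conj_conj] at this) hnorm
  set a := traceVector ad' 𝔮.toSubmodule with ha
  have hσ : σ a = -a := hc.conj_traceVector _
  -- Multiplication by i makes the anti-fixed a real and turns eigenvalues l into i l.
  refine ⟨Complex.I • a, ?_, ?_, ?_⟩
  · rw [h.conj_smul, hσ]; simp
  · have hS : 𝔮.toSubmodule = nonnegEigenSubmodule (Complex.I • a) := by
      rw [key]
      refine iSup_congr fun l => ?_
      ext x
      rw [Module.End.mem_eigenspace_iff, Module.End.mem_eigenspace_iff, LieAlgebra.ad_apply,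
        smul_lie, mul_smul]
      exact (smul_right_injective 𝔨 Complex.I_ne_zero).eq_iff.symm
    exact LieSubalgebra.toSubmodule_injective hS
  · intro u hu hB hm
    rw [map_smul]
    exact congrArg (Complex.I • ·) (map_traceVector ad' 𝔮.toSubmodule u (fun x y => hB x y) hu hm)

/-- κ(x, σ x) is minus the squared Hilbert–Schmidt norm of ad x. -/
theorem lie_eq_zero_of_killingForm_conj {x : 𝔨} (hx : killingForm ℂ 𝔨 x (σ x) = 0) (y : 𝔨) :
    ⁅x, y⁆ = 0 := by
  let _ := h.core.toNormedAddCommGroup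
  let _ := InnerProductSpace.ofCore h.core.toCore
  have hc := h.isCompactBracket
  obtain ⟨r, -, hr, hr0⟩ := trace_mul_adjoint_self (V := 𝔨) (LieAlgebra.ad ℂ 𝔨 x)
  have hk : killingForm ℂ 𝔨 x (σ x) = -(r : ℂ) := by
    rw [← hr, ← map_neg, ← mul_neg]
    have : -LinearMap.adjoint (LieAlgebra.ad ℂ 𝔨 x : 𝔨 →ₗ[ℂ] 𝔨) = LieAlgebra.ad ℂ 𝔨 (σ x) := by
      exact neg_eq_iff_eq_neg.mpr (hc.adjoint_ad x)
    rw [this]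
    rfl
  rw [hx, eq_comm, neg_eq_zero, Complex.ofReal_eq_zero] at hk
  exact congrArg (fun f : 𝔨 →ₗ[ℂ] 𝔨 => f y) (hr0 hk)

/-- A subspace that is stable under a real element lies in any subspace that contains its
eigenvectors. -/
theorem le_of_forall_eigenvector {a : 𝔨} (ha : σ a = a) {S S' : Submodule ℂ 𝔨}
    (hS : ∀ x ∈ S, ⁅a, x⁆ ∈ S)
    (hS' : ∀ μ : ℝ, ∀ x ∈ S, ⁅a, x⁆ = (Complex.I * μ) • x → x ∈ S') : S ≤ S' := by
  let _ := h.core.toNormedAddCommGroup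
  let _ := InnerProductSpace.ofCore h.core.toCore
  have hc := h.isCompactBracket
  have hb : σ (-Complex.I • a) = -(-Complex.I • a) := by
    rw [h.conj_smul, ha]; simp
  refine CRLie.le_of_forall_eigenvector (hc.isSymmetric_ad hb) (fun x hx => ?_) fun μ x hx hμ => ?_
  · have := S.smul_mem (-Complex.I) (hS x hx)
    rwa [← smul_lie] at this
  · refine hS' μ x hx ?_
    have h1 : ⁅-Complex.I • a, x⁆ = (μ : ℂ) • x := hμ
    rw [mul_smul, ← h1, smul_lie, smul_smul]
    simp

/-- For a stable subspace containing the kernel of `ad a`, with `a` real, the condition `⁅a, x⁆ ∈ S`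
implies `x ∈ S`. -/
theorem mem_of_lie_mem {a : 𝔨} (ha : σ a = a) {S : Submodule ℂ 𝔨}
    (hS : ∀ x ∈ S, ⁅a, x⁆ ∈ S) (h0 : ∀ x, ⁅a, x⁆ = 0 → x ∈ S) {x : 𝔨} (hx : ⁅a, x⁆ ∈ S) :
    x ∈ S := by
  have : S.comap (LieAlgebra.ad ℂ 𝔨 a) ≤ S := by
    refine h.le_of_forall_eigenvector ha (fun y hy => hS _ hy) fun μ y hy hμ => ?_
    by_cases hμ0 : μ = 0
    · exact h0 y (by rw [hμ, hμ0]; simp)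
    · have h1 : ⁅a, y⁆ ∈ S := hy
      rw [hμ] at h1
      exact (S.smul_mem_iff (mul_ne_zero Complex.I_ne_zero (by exact_mod_cast hμ0))).mp h1
  exact this hx

/-- B and -κ differ by pairings with central elements. These normalize 𝔟, hence lie in it, so
B-orthogonality to 𝔟 implies κ-orthogonality. -/
theorem _root_.CRLie.IsBorel.mem_of_form_eq_zero {𝔟 : LieSubalgebra ℂ 𝔨} (hb : IsBorel 𝔟)
    {x : 𝔨} (hx : ∀ y ∈ 𝔟, B y x = 0) : x ∈ 𝔟 := by
  obtain ⟨π, h1, h2⟩ := h.center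
  refine hb.mem_of_killingForm_eq_zero fun y hy => ?_
  have hπ : π y ∈ 𝔟 := hb.mem_of_lie_mem fun b _ => by
    rw [← lie_skew, h1, neg_zero]; exact zero_mem _
  have := h2 y x
  rw [hx y hy, hx _ hπ, add_zero, eq_comm, neg_eq_zero] at this
  exact this

/-- A parabolic subalgebra is the span of the nonnegative eigenspaces of a canonical element of the
real form. -/
theorem exists_eq_nonnegEigen_of_isParabolic {𝔮 : LieSubalgebra ℂ 𝔨} (hq : IsParabolic 𝔮) :
    ∃ a : 𝔨, σ a = a ∧ 𝔮 = nonnegEigen a ∧ ∀ u : 𝔨 ≃ₗ[ℂ] 𝔨, (∀ x y, u ⁅x, y⁆ = ⁅u x, u y⁆) →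
      (∀ x y, B (σ (u x)) (u y) = B (σ x) y) →
      𝔮.toSubmodule.map u.toLinearMap = 𝔮.toSubmodule → u a = a := by
  obtain ⟨𝔟, hb, hbq⟩ := hq
  obtain ⟨a, ha, hba, -⟩ := h.exists_eq_nonnegEigen (𝔮 := 𝔟) (fun x hx => hb.mem_of_form_eq_zero h hx)
    (fun x hx => hb.mem_of_lie_mem fun y hy => by rw [← lie_skew]; exact neg_mem (hx y hy))
  have h0 : ∀ x, ⁅a, x⁆ = 0 → x ∈ 𝔟 := by
    intro x hx
    rw [hba]
    refine Submodule.mem_iSup_of_mem ⟨0, le_rfl⟩ (Module.End.mem_eigenspace_iff.mpr ?_)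
    simpa using hx
  have haq : a ∈ 𝔮 := hbq (h0 a (lie_self a))
  refine h.exists_eq_nonnegEigen (fun x hx => hbq (hb.mem_of_form_eq_zero h fun y hy => hx y (hbq hy)))
    fun x hx => ?_
  -- If x normalizes 𝔮 then [a, x] ∈ 𝔮, where a defines the Borel subalgebra. Since ad a is
  -- diagonalizable with kernel inside 𝔮, x itself lies in 𝔮.
  refine h.mem_of_lie_mem (S := 𝔮.toSubmodule) ha (fun y hy => 𝔮.lie_mem haq hy)
    (fun y hy => hbq (h0 y hy)) ?_
  rw [← lie_skew]
  exact neg_mem (hx a haq)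

/-- The span of the nonnegative eigenspaces of a real element is parabolic. -/
theorem isParabolic_nonnegEigen {a : 𝔨} (ha : σ a = a) : IsParabolic (nonnegEigen a) := by
  obtain ⟨δ, M, hδ, hδM⟩ := exists_pos_le_eigenvalue a
  have hW := isSolvable_eigenGe a hδ fun μ x h1 h2 h3 => (hδM μ x h1 h2 h3).2
  have hWa : ∀ b ∈ eigenGe a δ hδ.le, ⁅b, a⁆ ∈ eigenGe a δ hδ.le := fun b hb => by
    rw [← lie_skew]; exact neg_mem (self_lie_mem_eigenGeSubmodule a hb)
  obtain ⟨𝔟, hb, hle⟩ := exists_isBorel_ge (isSolvable_adjoin hW hWa)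
  have hab : a ∈ 𝔟 := hle (mem_adjoin.mpr ⟨0, zero_mem _, 1, by simp⟩)
  have hWb : ∀ x ∈ eigenGeSubmodule a δ, x ∈ 𝔟 := fun x hx =>
    hle (mem_adjoin.mpr ⟨x, hx, 0, by simp⟩)
  refine ⟨𝔟, hb, ?_⟩
  refine h.le_of_forall_eigenvector (S := 𝔟.toSubmodule) (S' := nonnegEigenSubmodule a) ha
    (fun x hx => 𝔟.lie_mem hab hx) fun μ x hx hμ => ?_
  rcases le_or_gt 0 μ with h0 | h0
  · exact mem_eigenGeSubmodule h0 hμ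
  by_cases hx0 : x = 0
  · rw [hx0]; exact zero_mem _
  exfalso
  have hσ : ⁅a, σ x⁆ = (Complex.I * ((-μ : ℝ) : ℂ)) • σ x := by
    conv_lhs => rw [← ha]
    rw [← h.conj_lie, hμ, h.conj_smul]
    simp
  have hσ0 : σ x ≠ 0 := fun h0 => hx0 (by rw [← h.conj_conj x, h0, h.conj_zero])
  have hσb : σ x ∈ 𝔟 :=
    hWb _ (mem_eigenGeSubmodule (hδM (-μ) _ (by linarith) hσ hσ0).1 hσ)
  -- Solvability of 𝔟 gives κ(σ x, [a, x]) = 0, so κ(σ x, x) = 0 and ad x = 0, against μ ≠ 0.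
  have hk := trace_ad_mul_ad_lie hb.prop hab hx hσb
  have hμ0 : Complex.I * (μ : ℂ) ≠ 0 := mul_ne_zero Complex.I_ne_zero (by exact_mod_cast h0.ne)
  rw [hμ, map_smul, smul_eq_zero_iff_right hμ0] at hk
  have hz := h.lie_eq_zero_of_killingForm_conj
    ((LieModule.traceForm_comm ℂ 𝔨 𝔨 x (σ x)).trans hk) a
  rw [← lie_skew, neg_eq_zero, hμ, smul_eq_zero_iff_right hμ0] at hz
  exact hx0 hz

end IsCompactConj
end CompactConjugation

/-! ### Passage from a compact real Lie algebra to its complexification. -/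

section CompactForm

variable {𝔨₀ : Type*} [LieRing 𝔨₀] [LieAlgebra ℝ 𝔨₀]

/-- An invariant inner product on a real Lie algebra that agrees with the opposite of the Killing
form up to a term carried by the center. -/
structure IsCompactForm (β : LinearMap.BilinForm ℝ 𝔨₀) : Prop where
  symm : ∀ x y, β x y = β y x
  pos : ∀ x, x ≠ 0 → 0 < β x x
  inv : ∀ x y z : 𝔨₀, β ⁅x, y⁆ z = -β y ⁅x, z⁆
  center : ∃ π : 𝔨₀ →ₗ[ℝ] 𝔨₀, (∀ x y : 𝔨₀, ⁅π x, y⁆ = 0) ∧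
    ∀ x y, β x y = -killingForm ℝ 𝔨₀ x y + β (π x) y

@[simp] theorem conjC_tmul (z : ℂ) (x : 𝔨₀) :
    conjC 𝔨₀ (z ⊗ₜ x) = (starRingEnd ℂ z) ⊗ₜ[ℝ] x := rfl

theorem conjC_conjC (x : ℂ ⊗[ℝ] 𝔨₀) : conjC 𝔨₀ (conjC 𝔨₀ x) = x := by
  induction x with
  | zero => simp
  | tmul z x => simp
  | add x y hx hy => rw [map_add, map_add, hx, hy]

theorem conjC_smul (c : ℂ) (x : ℂ ⊗[ℝ] 𝔨₀) :
    conjC 𝔨₀ (c • x) = (starRingEnd ℂ c) • conjC 𝔨₀ x := by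
  induction x with
  | zero => simp
  | tmul z x => simp [TensorProduct.smul_tmul']
  | add x y hx hy => rw [smul_add, map_add, map_add, hx, hy, smul_add]

theorem ad_tmul (a b : ℂ) (x y : 𝔨₀) :
    LieAlgebra.ad ℂ (ℂ ⊗[ℝ] 𝔨₀) (a ⊗ₜ x) (b ⊗ₜ y) = (a * b) ⊗ₜ[ℝ] ⁅x, y⁆ := rfl

/-- Two biadditive maps on the complexification agree if they agree on pure tensors. -/
theorem biadditive_ext {M : Type*} [AddCommGroup M] (f g : ℂ ⊗[ℝ] 𝔨₀ → ℂ ⊗[ℝ] 𝔨₀ → M)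
    (hf : ∀ x x' y, f (x + x') y = f x y + f x' y) (hf' : ∀ x y y', f x (y + y') = f x y + f x y')
    (hg : ∀ x x' y, g (x + x') y = g x y + g x' y) (hg' : ∀ x y y', g x (y + y') = g x y + g x y')
    (h : ∀ a x b y, f (a ⊗ₜ x) (b ⊗ₜ y) = g (a ⊗ₜ x) (b ⊗ₜ y)) (x y : ℂ ⊗[ℝ] 𝔨₀) :
    f x y = g x y := by
  have z1 : ∀ (k : ℂ ⊗[ℝ] 𝔨₀ → ℂ ⊗[ℝ] 𝔨₀ → M), (∀ x x' y, k (x + x') y = k x y + k x' y) →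
      ∀ y, k 0 y = 0 := fun k hk y => by simpa using hk 0 0 y
  have z2 : ∀ (k : ℂ ⊗[ℝ] 𝔨₀ → ℂ ⊗[ℝ] 𝔨₀ → M), (∀ x y y', k x (y + y') = k x y + k x y') →
      ∀ x, k x 0 = 0 := fun k hk x => by simpa using hk x 0 0
  induction x with
  | zero => rw [z1 f hf, z1 g hg]
  | add x x' hx hx' => rw [hf, hg, hx, hx']
  | tmul a x =>
    induction y with
    | zero => rw [z2 f hf', z2 g hg']
    | add y y' hy hy' => rw [hf', hg', hy, hy']
    | tmul b y => exact h a x b y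

theorem conjC_ad (x y : ℂ ⊗[ℝ] 𝔨₀) : conjC 𝔨₀ (LieAlgebra.ad ℂ (ℂ ⊗[ℝ] 𝔨₀) x y) =
    LieAlgebra.ad ℂ (ℂ ⊗[ℝ] 𝔨₀) (conjC 𝔨₀ x) (conjC 𝔨₀ y) := by
  refine biadditive_ext (fun x y => conjC 𝔨₀ (LieAlgebra.ad ℂ (ℂ ⊗[ℝ] 𝔨₀) x y))
    (fun x y => LieAlgebra.ad ℂ (ℂ ⊗[ℝ] 𝔨₀) (conjC 𝔨₀ x) (conjC 𝔨₀ y)) ?_ ?_ ?_ ?_ ?_ x y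
  all_goals intros; simp only [map_add, LinearMap.add_apply, ad_tmul, conjC_tmul, map_mul]

theorem exists_eq_re_add_im (x : ℂ ⊗[ℝ] 𝔨₀) :
    ∃ a b : 𝔨₀, x = (1 : ℂ) ⊗ₜ[ℝ] a + Complex.I • ((1 : ℂ) ⊗ₜ[ℝ] b) := by
  induction x with
  | zero => exact ⟨0, 0, by simp⟩
  | tmul z x =>
    refine ⟨z.re • x, z.im • x, ?_⟩
    rw [TensorProduct.tmul_smul, TensorProduct.tmul_smul, TensorProduct.smul_tmul',
      TensorProduct.smul_tmul', TensorProduct.smul_tmul', ← TensorProduct.add_tmul]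
    congr 1
    apply Complex.ext <;> simp
  | add x y hx hy =>
    obtain ⟨a, b, rfl⟩ := hx
    obtain ⟨c, d, rfl⟩ := hy
    refine ⟨a + c, b + d, ?_⟩
    rw [TensorProduct.tmul_add, TensorProduct.tmul_add, smul_add]
    abel

theorem exists_eq_tmul_of_conjC_eq {x : ℂ ⊗[ℝ] 𝔨₀} (hx : conjC 𝔨₀ x = x) :
    ∃ a : 𝔨₀, x = (1 : ℂ) ⊗ₜ[ℝ] a := by
  obtain ⟨a, b, rfl⟩ := exists_eq_re_add_im x
  refine ⟨a, ?_⟩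
  rw [map_add, conjC_smul, conjC_tmul, conjC_tmul, map_one, Complex.conj_I, add_right_inj] at hx
  have h2 : (2 * Complex.I) • ((1 : ℂ) ⊗ₜ[ℝ] b) = 0 := by
    have := sub_eq_zero.mpr hx.symm
    rw [← this]; module
  rw [mul_smul, smul_eq_zero_iff_right two_ne_zero] at h2
  rw [h2, add_zero]

theorem tmul_one_injective : Function.Injective fun x : 𝔨₀ => (1 : ℂ) ⊗ₜ[ℝ] x := by
  intro x y hxy
  have hxy : (1 : ℂ) ⊗ₜ[ℝ] x = (1 : ℂ) ⊗ₜ[ℝ] y := hxy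
  rw [← sub_eq_zero, ← TensorProduct.tmul_sub, Module.FaithfullyFlat.one_tmul_eq_zero_iff] at hxy
  exact sub_eq_zero.mp hxy

theorem baseChange_ad (u : 𝔨₀ →ₗ[ℝ] 𝔨₀) (hu : ∀ x y : 𝔨₀, u ⁅x, y⁆ = ⁅u x, u y⁆)
    (x y : ℂ ⊗[ℝ] 𝔨₀) : u.baseChange ℂ (LieAlgebra.ad ℂ (ℂ ⊗[ℝ] 𝔨₀) x y) =
      LieAlgebra.ad ℂ (ℂ ⊗[ℝ] 𝔨₀) (u.baseChange ℂ x) (u.baseChange ℂ y) := by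
  refine biadditive_ext (fun x y => u.baseChange ℂ (LieAlgebra.ad ℂ (ℂ ⊗[ℝ] 𝔨₀) x y))
    (fun x y => LieAlgebra.ad ℂ (ℂ ⊗[ℝ] 𝔨₀) (u.baseChange ℂ x) (u.baseChange ℂ y))
    ?_ ?_ ?_ ?_ ?_ x y
  · intros; simp only [map_add, LinearMap.add_apply]
  · intros; simp only [map_add]
  · intros; simp only [map_add, LinearMap.add_apply]
  · intros; simp only [map_add]
  · intro a x b y
    simp only [ad_tmul, LinearMap.baseChange_tmul, hu]

namespace IsCompactForm

variable {β : LinearMap.BilinForm ℝ 𝔨₀} (h : IsCompactForm β)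
include h

theorem isCompactConj [FiniteDimensional ℝ 𝔨₀] :
    IsCompactConj (conjC 𝔨₀) (β.baseChange ℂ) := by
  have hconj : ∀ x y, β.baseChange ℂ (conjC 𝔨₀ x) (conjC 𝔨₀ y) =
      starRingEnd ℂ (β.baseChange ℂ x y) := by
    refine biadditive_ext _ _ ?_ ?_ ?_ ?_ ?_
    all_goals intros; simp
  have hre : ∀ a b : 𝔨₀, β.baseChange ℂ
      (conjC 𝔨₀ ((1 : ℂ) ⊗ₜ[ℝ] a + Complex.I • ((1 : ℂ) ⊗ₜ[ℝ] b)))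
      ((1 : ℂ) ⊗ₜ[ℝ] a + Complex.I • ((1 : ℂ) ⊗ₜ[ℝ] b)) = ((β a a + β b b : ℝ) : ℂ) := by
    intro a b
    simp only [map_add, conjC_smul, conjC_tmul, map_one, Complex.conj_I, LinearMap.add_apply,
      map_smul, LinearMap.smul_apply, LinearMap.BilinForm.baseChange_tmul, h.symm b a, smul_eq_mul]
    push_cast
    simp
    ring_nf
    simp
  have hnn : ∀ a, 0 ≤ β a a := fun a => by
    by_cases ha : a = 0
    · simp [ha]
    · exact (h.pos a ha).le
  have h0 : ∀ a, β a a = 0 → a = 0 := fun a ha => by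
    by_contra hne
    exact (h.pos a hne).ne' ha
  refine
    { conj_conj := conjC_conjC
      conj_add := map_add _
      conj_smul := conjC_smul
      conj_lie := conjC_ad
      form_conj := hconj
      form_symm := ?_
      form_nonneg := fun x => ?_
      form_definite := fun x hx => ?_
      form_lie := ?_
      center := ?_ }
  · refine biadditive_ext _ _ ?_ ?_ ?_ ?_ ?_
    · intros; simp
    · intros; simp
    · intros; simp
    · intros; simp
    · intro a x b y
      rw [LinearMap.BilinForm.baseChange_tmul, LinearMap.BilinForm.baseChange_tmul, h.symm, mul_comm b a]
  · obtain ⟨a, b, rfl⟩ := exists_eq_re_add_im x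
    rw [hre, Complex.ofReal_re]
    exact add_nonneg (hnn a) (hnn b)
  · obtain ⟨a, b, rfl⟩ := exists_eq_re_add_im x
    rw [hre, Complex.ofReal_eq_zero] at hx
    rw [h0 a (by linarith [hnn a, hnn b]), h0 b (by linarith [hnn a, hnn b])]
    simp
  · intro x y z
    change β.baseChange ℂ (LieAlgebra.ad ℂ _ x y) z = -β.baseChange ℂ y (LieAlgebra.ad ℂ _ x z)
    induction z with
    | zero => simp
    | add z z' hz hz' => simp only [map_add, hz, hz']; ring
    | tmul c z =>
      refine biadditive_ext (fun x y => β.baseChange ℂ (LieAlgebra.ad ℂ _ x y) (c ⊗ₜ z))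
        (fun x y => -β.baseChange ℂ y (LieAlgebra.ad ℂ _ x (c ⊗ₜ z))) ?_ ?_ ?_ ?_ ?_ x y
      · intros; simp only [map_add, LinearMap.add_apply]
      · intros; simp only [map_add, LinearMap.add_apply]
      · intros; simp only [map_add, LinearMap.add_apply, neg_add]
      · intros; simp only [map_add, LinearMap.add_apply, neg_add]
      · intro a x b y
        simp only [ad_tmul, LinearMap.BilinForm.baseChange_tmul, h.inv]
        simp [mul_left_comm, mul_assoc]
  · obtain ⟨π, h1, h2⟩ := h.center
    refine ⟨π.baseChange ℂ, ?_, ?_⟩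
    · refine biadditive_ext (fun x y => LieAlgebra.ad ℂ (ℂ ⊗[ℝ] 𝔨₀) (π.baseChange ℂ x) y)
        (fun _ _ => 0) ?_ ?_ ?_ ?_ ?_
      · intros; simp only [map_add, LinearMap.add_apply]
      · intros; simp only [map_add]
      · simp
      · simp
      · intro a x b y
        simp only [LinearMap.baseChange_tmul, ad_tmul, h1, TensorProduct.tmul_zero]
    · refine biadditive_ext _ _ ?_ ?_ ?_ ?_ ?_
      · intros; simp
      · intros; simp
      · intros; simp only [map_add, LinearMap.add_apply]; ring
      · intros; simp only [map_add]; ring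
      · intro a x b y
        have hk : killingForm ℂ (ℂ ⊗[ℝ] 𝔨₀) = (killingForm ℝ 𝔨₀).baseChange ℂ :=
          LieModule.traceForm_baseChange ℝ 𝔨₀ 𝔨₀ ℂ
        rw [hk]
        simp only [LinearMap.BilinForm.baseChange_tmul, LinearMap.baseChange_tmul]
        rw [h2 x y, add_smul, neg_smul]

theorem isParabolic_q [FiniteDimensional ℝ 𝔨₀] (A : 𝔨₀) : IsParabolic (q A) :=
  h.isCompactConj.isParabolic_nonnegEigen (by simp)

theorem exists_eq_q [FiniteDimensional ℝ 𝔨₀] {𝔮 : LieSubalgebra ℂ (ℂ ⊗[ℝ] 𝔨₀)}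
    (hq : IsParabolic 𝔮) : ∃ A : 𝔨₀, 𝔮 = q A ∧ ∀ u : 𝔨₀ ≃ₗ[ℝ] 𝔨₀,
      (∀ x y : 𝔨₀, u ⁅x, y⁆ = ⁅u x, u y⁆) → (∀ x y, β (u x) (u y) = β x y) →
      𝔮.toSubmodule.map (u.toLinearMap.baseChange ℂ) = 𝔮.toSubmodule → u A = A := by
  obtain ⟨a, ha, haq, hu⟩ := h.isCompactConj.exists_eq_nonnegEigen_of_isParabolic hq
  obtain ⟨A, rfl⟩ := exists_eq_tmul_of_conjC_eq ha
  refine ⟨A, haq, fun u hlie hβ hmap => tmul_one_injective ?_⟩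
  refine hu (u.baseChange ℝ ℂ _ _) ?_ ?_ hmap
  · exact baseChange_ad u.toLinearMap hlie
  · refine biadditive_ext _ _ ?_ ?_ ?_ ?_ ?_
    · intros; simp
    · intros; simp
    · intros; simp
    · intros; simp
    · intro a x b y
      simp [hβ]

end IsCompactForm

theorem map_q_le (u : 𝔨₀ →ₗ[ℝ] 𝔨₀) (hu : ∀ x y : 𝔨₀, u ⁅x, y⁆ = ⁅u x, u y⁆) {A : 𝔨₀}
    (hA : u A = A) : (q A).toSubmodule.map (u.baseChange ℂ) ≤ (q A).toSubmodule := by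
  rw [Submodule.map_le_iff_le_comap]
  refine iSup_le fun l x hx => Submodule.mem_iSup_of_mem l ?_
  rw [Module.End.mem_eigenspace_iff] at hx ⊢
  have h1 := baseChange_ad u hu ((1 : ℂ) ⊗ₜ A) x
  rw [LinearMap.baseChange_tmul, hA] at h1
  rw [← h1, hx, map_smul]

/-- An automorphism fixing `A` preserves `𝔮_A`. -/
theorem map_q (u : 𝔨₀ ≃ₗ[ℝ] 𝔨₀) (hu : ∀ x y : 𝔨₀, u ⁅x, y⁆ = ⁅u x, u y⁆) {A : 𝔨₀} (hA : u A = A) :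
    (q A).toSubmodule.map (u.toLinearMap.baseChange ℂ) = (q A).toSubmodule := by
  refine le_antisymm (map_q_le u.toLinearMap hu hA) fun x hx => ?_
  have hu' : ∀ x y : 𝔨₀, u.symm ⁅x, y⁆ = ⁅u.symm x, u.symm y⁆ := fun x y => by
    rw [LinearEquiv.symm_apply_eq, hu, u.apply_symm_apply, u.apply_symm_apply]
  have hA' : u.symm A = A := by rw [LinearEquiv.symm_apply_eq, hA]
  refine ⟨u.symm.toLinearMap.baseChange ℂ x,
    map_q_le u.symm.toLinearMap hu' hA' ⟨x, hx, rfl⟩, ?_⟩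
  rw [← LinearMap.comp_apply, ← LinearMap.baseChange_comp]
  simp

end CompactForm

/-- The type of `mfderiv` depends on the base point; viewing it on the model spaces lets g · 1 · g⁻¹
be replaced by 1. -/
theorem mfderiv_point {E F : Type*} [NormedAddCommGroup E] [NormedSpace ℝ E]
    [NormedAddCommGroup F] [NormedSpace ℝ F] {G M : Type*} [TopologicalSpace G]
    [ChartedSpace E G] [TopologicalSpace M] [ChartedSpace F M] (f : G → M) {x y : G} (h : x = y) :
    (mfderiv 𝓘(ℝ, E) 𝓘(ℝ, F) f x : E →L[ℝ] F) = (mfderiv 𝓘(ℝ, E) 𝓘(ℝ, F) f y : E →L[ℝ] F) := by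
  subst h; rfl

/-! ### The adjoint representation of a Lie group and its derivative. -/

section AdjointRepresentation

variable {E : Type*} [NormedAddCommGroup E] [NormedSpace ℝ E]
  {G : Type*} [TopologicalSpace G] [ChartedSpace E G] [Group G]

/-- `Ad g` as a continuous linear map on the model space. -/
def AdL (g : G) : E →L[ℝ] E := mfderiv 𝓘(ℝ, E) 𝓘(ℝ, E) (fun h : G => g * h * g⁻¹) (1 : G)

theorem AdL_one : AdL (E := E) (1 : G) = ContinuousLinearMap.id ℝ E := by
  have : (fun h : G => 1 * h * 1⁻¹) = id := by ext; simp
  rw [AdL, this]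
  exact mfderiv_id

theorem fderiv_comp_extChartAt_symm {F : Type*} [NormedAddCommGroup F] [NormedSpace ℝ F]
    {f : G → F} (hf : MDifferentiableAt 𝓘(ℝ, E) 𝓘(ℝ, F) f 1) :
    HasFDerivAt (f ∘ (extChartAt 𝓘(ℝ, E) (1 : G)).symm)
      (mfderiv 𝓘(ℝ, E) 𝓘(ℝ, F) f 1 : E →L[ℝ] F) (extChartAt 𝓘(ℝ, E) (1 : G) 1) := by
  have h1 : HasFDerivWithinAt (f ∘ (extChartAt 𝓘(ℝ, E) (1 : G)).symm)
      (mfderiv 𝓘(ℝ, E) 𝓘(ℝ, F) f 1 : E →L[ℝ] F) Set.univ (extChartAt 𝓘(ℝ, E) (1 : G) 1) := by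
    have := hf.hasMFDerivAt.2
    simpa only [writtenInExtChartAt, extChartAt_model_space_eq_id, PartialEquiv.refl_coe,
      Function.id_comp, ModelWithCorners.range_eq_univ] using this
  exact hasFDerivWithinAt_univ.mp h1

variable (E G) in
/-- The origin of the chart at the identity. -/
def chartOne : E := extChartAt 𝓘(ℝ, E) (1 : G) 1

theorem target_mem_nhds_chartOne : (extChartAt 𝓘(ℝ, E) (1 : G)).target ∈ nhds (chartOne E G) :=
  extChartAt_target_mem_nhds 1

theorem symm_chartOne : (extChartAt 𝓘(ℝ, E) (1 : G)).symm (chartOne E G) = 1 :=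
  extChartAt_to_inv 1

variable (E G) in
/-- The product of the group in the chart at the identity. -/
def chartMul (p : E × E) : E :=
  extChartAt 𝓘(ℝ, E) (1 : G)
    ((extChartAt 𝓘(ℝ, E) (1 : G)).symm p.1 * (extChartAt 𝓘(ℝ, E) (1 : G)).symm p.2)

/-- Left translations in the chart. -/
theorem fderiv_chartMul_right {x : E} (hx : DifferentiableAt ℝ (chartMul E G) (x, chartOne E G))
    (hx' : MDifferentiableAt 𝓘(ℝ, E) 𝓘(ℝ, E) (fun h : G => extChartAt 𝓘(ℝ, E) (1 : G)
      ((extChartAt 𝓘(ℝ, E) (1 : G)).symm x * h)) 1) (Y : E) :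
    fderiv ℝ (chartMul E G) (x, chartOne E G) (0, Y) =
      (mfderiv 𝓘(ℝ, E) 𝓘(ℝ, E) (fun h : G => extChartAt 𝓘(ℝ, E) (1 : G)
      ((extChartAt 𝓘(ℝ, E) (1 : G)).symm x * h)) 1 : E →L[ℝ] E) Y := by
  have h1 := fderiv_comp_extChartAt_symm hx'
  have h2 := hx.hasFDerivAt.comp (chartOne E G) (hasFDerivAt_prodMk_right x (chartOne E G))
  have := h2.unique h1
  exact congrArg (fun T : E →L[ℝ] E => T Y) this

theorem fderiv_chartMul_left {x : E} (hx : DifferentiableAt ℝ (chartMul E G) (chartOne E G, x))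
    (hx' : MDifferentiableAt 𝓘(ℝ, E) 𝓘(ℝ, E) (fun h : G => extChartAt 𝓘(ℝ, E) (1 : G)
      (h * (extChartAt 𝓘(ℝ, E) (1 : G)).symm x)) 1) (Y : E) :
    fderiv ℝ (chartMul E G) (chartOne E G, x) (Y, 0) =
      (mfderiv 𝓘(ℝ, E) 𝓘(ℝ, E) (fun h : G => extChartAt 𝓘(ℝ, E) (1 : G)
      (h * (extChartAt 𝓘(ℝ, E) (1 : G)).symm x)) 1 : E →L[ℝ] E) Y := by
  have h1 := fderiv_comp_extChartAt_symm hx'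
  have h2 := HasFDerivAt.comp (f := fun e : E => (e, x)) (chartOne E G) hx.hasFDerivAt
    (hasFDerivAt_prodMk_left (𝕜 := ℝ) (chartOne E G) x)
  have := h2.unique h1
  exact congrArg (fun T : E →L[ℝ] E => T Y) this

theorem chartMul_one_left_eventuallyEq :
    (fun y => chartMul E G (chartOne E G, y)) =ᶠ[nhds (chartOne E G)] id := by
  filter_upwards [target_mem_nhds_chartOne (E := E) (G := G)] with y hy
  rw [chartMul, symm_chartOne, one_mul]
  exact (extChartAt 𝓘(ℝ, E) (1 : G)).right_inv hy

theorem chartMul_one_right_eventuallyEq :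
    (fun y => chartMul E G (y, chartOne E G)) =ᶠ[nhds (chartOne E G)] id := by
  filter_upwards [target_mem_nhds_chartOne (E := E) (G := G)] with y hy
  rw [chartMul, symm_chartOne, mul_one]
  exact (extChartAt 𝓘(ℝ, E) (1 : G)).right_inv hy

variable [LieGroup 𝓘(ℝ, E) ∞ G]

theorem inTangentCoordinates_of_eq {N : Type*} {x₀ x : N} {f g : N → G} (ϕ : N → E →L[ℝ] E)
    (hf : f x = f x₀) (hg : g x = g x₀) :
    inTangentCoordinates 𝓘(ℝ, E) 𝓘(ℝ, E) f g ϕ x₀ x = ϕ x := by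
  rw [inTangentCoordinates_eq]
  · ext v
    simp only [ContinuousLinearMap.comp_apply, hf, hg]
    rw [(tangentBundleCore 𝓘(ℝ, E) G).coordChange_self _ _ (mem_achart_source E _),
      (tangentBundleCore 𝓘(ℝ, E) G).coordChange_self _ _ (mem_achart_source E _)]
  · rw [hf]; exact mem_chart_source _ _
  · rw [hg]; exact mem_chart_source _ _

theorem contMDiff_conj : ContMDiff (𝓘(ℝ, E).prod 𝓘(ℝ, E)) 𝓘(ℝ, E) ∞
    (fun p : G × G => p.1 * p.2 * p.1⁻¹) :=
  (contMDiff_fst.mul contMDiff_snd).mul contMDiff_fst.inv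

theorem contMDiff_conj_right (g : G) : ContMDiff 𝓘(ℝ, E) 𝓘(ℝ, E) ∞ (fun h : G => g * h * g⁻¹) :=
  (contMDiff_const.mul contMDiff_id).mul contMDiff_const

/-- Derivatives depending on a parameter are smooth in tangent coordinates. Conjugation fixes 1, so
source and target base points are constant and these coordinate changes are trivial. -/
theorem contMDiff_AdL : ContMDiff 𝓘(ℝ, E) 𝓘(ℝ, E →L[ℝ] E) ∞ (AdL (E := E) (G := G)) := by
  intro g₀
  have h := ContMDiffAt.mfderiv (I := 𝓘(ℝ, E)) (I' := 𝓘(ℝ, E)) (J := 𝓘(ℝ, E)) (n := ∞) (m := ∞) (x₀ := g₀)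
    (fun (g : G) (h : G) => g * h * g⁻¹) (fun _ => (1 : G)) contMDiff_conj.contMDiffAt
    contMDiffAt_const le_rfl
  have h' : ContMDiffAt 𝓘(ℝ, E) 𝓘(ℝ, E →L[ℝ] E) ∞ (inTangentCoordinates 𝓘(ℝ, E) 𝓘(ℝ, E)
      (fun _ => (1 : G)) (fun x : G => x * 1 * x⁻¹) (fun g : G => AdL (E := E) g) g₀) g₀ := h
  refine h'.congr_of_eventuallyEq (Filter.Eventually.of_forall fun g => ?_)
  exact (inTangentCoordinates_of_eq (x := g) (x₀ := g₀) (f := fun _ => (1 : G))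
    (g := fun x : G => x * 1 * x⁻¹) (fun g : G => AdL (E := E) g) rfl (by simp)).symm

theorem AdL_mul (g h : G) : AdL (E := E) (g * h) = (AdL g).comp (AdL h) := by
  have h1 : (fun x : G => g * h * x * (g * h)⁻¹) =
      (fun x => g * x * g⁻¹) ∘ (fun x => h * x * h⁻¹) := by
    ext x; simp [mul_assoc]
  have h2 := mfderiv_comp (I := 𝓘(ℝ, E)) (I' := 𝓘(ℝ, E)) (I'' := 𝓘(ℝ, E)) (1 : G)
    ((contMDiff_conj_right (E := E) g).mdifferentiableAt (by simp) (x := h * 1 * h⁻¹))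
    ((contMDiff_conj_right (E := E) h).mdifferentiableAt (by simp) (x := 1))
  have h3 := mfderiv_point (E := E) (F := E) (fun x => g * x * g⁻¹) (show h * 1 * h⁻¹ = 1 by simp)
  rw [AdL, h1]
  refine h2.trans ?_
  exact congrArg (fun T : E →L[ℝ] E => T.comp (AdL h)) h3

theorem contMDiffAt_chart_symm : ContMDiffAt 𝓘(ℝ, E) 𝓘(ℝ, E) ∞ (extChartAt 𝓘(ℝ, E) (1 : G)).symm
    (chartOne E G) :=
  (contMDiffOn_extChartAt_symm 1).contMDiffAt target_mem_nhds_chartOne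

theorem contDiffAt_chartMul : ContDiffAt ℝ ∞ (chartMul E G) (chartOne E G, chartOne E G) := by
  rw [← contMDiffAt_iff_contDiffAt]
  have h1 : ContMDiffAt 𝓘(ℝ, E × E) 𝓘(ℝ, E) ∞
      (fun p : E × E => (extChartAt 𝓘(ℝ, E) (1 : G)).symm p.1) (chartOne E G, chartOne E G) :=
    ContMDiffAt.comp (chartOne E G, chartOne E G) contMDiffAt_chart_symm
      (contDiffAt_fst.contMDiffAt)
  have h2 : ContMDiffAt 𝓘(ℝ, E × E) 𝓘(ℝ, E) ∞
      (fun p : E × E => (extChartAt 𝓘(ℝ, E) (1 : G)).symm p.2) (chartOne E G, chartOne E G) :=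
    ContMDiffAt.comp (chartOne E G, chartOne E G) contMDiffAt_chart_symm
      (contDiffAt_snd.contMDiffAt)
  refine ContMDiffAt.comp (I' := 𝓘(ℝ, E)) (chartOne E G, chartOne E G) ?_ (h1.mul h2)
  refine contMDiffAt_extChartAt' ?_
  change (extChartAt 𝓘(ℝ, E) (1 : G)).symm (chartOne E G) *
    (extChartAt 𝓘(ℝ, E) (1 : G)).symm (chartOne E G) ∈ _
  rw [symm_chartOne, one_mul]
  exact mem_chart_source _ _

theorem mdifferentiableAt_chart_mul_left {x : E} (hx : x ∈ (extChartAt 𝓘(ℝ, E) (1 : G)).target) :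
    MDifferentiableAt 𝓘(ℝ, E) 𝓘(ℝ, E) (fun h : G => extChartAt 𝓘(ℝ, E) (1 : G)
      ((extChartAt 𝓘(ℝ, E) (1 : G)).symm x * h)) 1 := by
  refine MDifferentiableAt.comp (I' := 𝓘(ℝ, E)) (1 : G) (g := extChartAt 𝓘(ℝ, E) (1 : G)) ?_
    ((contMDiff_mul_left (I := 𝓘(ℝ, E)) (n := ∞)).mdifferentiableAt (by simp))
  rw [mul_one]
  refine mdifferentiableAt_extChartAt ?_
  simpa using (extChartAt 𝓘(ℝ, E) (1 : G)).map_target hx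

theorem mdifferentiableAt_chart_mul_right {x : E} (hx : x ∈ (extChartAt 𝓘(ℝ, E) (1 : G)).target) :
    MDifferentiableAt 𝓘(ℝ, E) 𝓘(ℝ, E) (fun h : G => extChartAt 𝓘(ℝ, E) (1 : G)
      (h * (extChartAt 𝓘(ℝ, E) (1 : G)).symm x)) 1 := by
  refine MDifferentiableAt.comp (I' := 𝓘(ℝ, E)) (1 : G) (g := extChartAt 𝓘(ℝ, E) (1 : G)) ?_
    ((contMDiff_mul_right (I := 𝓘(ℝ, E)) (n := ∞)).mdifferentiableAt (by simp))
  rw [one_mul]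
  refine mdifferentiableAt_extChartAt ?_
  simpa using (extChartAt 𝓘(ℝ, E) (1 : G)).map_target hx

/-- The two descriptions of a left-invariant vector field in the chart. -/
theorem fderiv_chartMul_eq {x : E} (hx : x ∈ (extChartAt 𝓘(ℝ, E) (1 : G)).target)
    (h1 : DifferentiableAt ℝ (chartMul E G) (x, chartOne E G))
    (h2 : DifferentiableAt ℝ (chartMul E G) (chartOne E G, x)) (Y : E) :
    fderiv ℝ (chartMul E G) (x, chartOne E G) (0, Y) =
      fderiv ℝ (chartMul E G) (chartOne E G, x)
        (AdL ((extChartAt 𝓘(ℝ, E) (1 : G)).symm x) Y, 0) := by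
  rw [fderiv_chartMul_right h1 (mdifferentiableAt_chart_mul_left hx),
    fderiv_chartMul_left h2 (mdifferentiableAt_chart_mul_right hx)]
  set g := (extChartAt 𝓘(ℝ, E) (1 : G)).symm x with hg
  have e : (fun h : G => extChartAt 𝓘(ℝ, E) (1 : G) (g * h)) =
      (fun h : G => extChartAt 𝓘(ℝ, E) (1 : G) (h * g)) ∘ (fun h => g * h * g⁻¹) := by
    ext h; simp
  have hc : g * 1 * g⁻¹ = 1 := by simp
  have hd : MDifferentiableAt 𝓘(ℝ, E) 𝓘(ℝ, E)
      (fun h : G => extChartAt 𝓘(ℝ, E) (1 : G) (h * g)) (g * 1 * g⁻¹) := by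
    rw [hc]; exact mdifferentiableAt_chart_mul_right hx
  have h3 := mfderiv_comp (I := 𝓘(ℝ, E)) (I' := 𝓘(ℝ, E)) (I'' := 𝓘(ℝ, E)) (1 : G) hd
    ((contMDiff_conj_right (E := E) g).mdifferentiableAt (by simp) (x := 1))
  rw [← e] at h3
  have h4 := mfderiv_point (E := E) (F := E) (fun h : G => extChartAt 𝓘(ℝ, E) (1 : G) (h * g)) hc
  have h5 := congrArg (fun T : E →L[ℝ] E => T Y) h3
  refine h5.trans ?_
  exact congrArg (fun T : E →L[ℝ] E => T (AdL g Y)) h4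

variable (E G) in
/-- The bracket of the Lie algebra of `G`, on the model space. -/
def modelBracket (X Y : E) : E :=
  Bracket.bracket (L := GroupLieAlgebra 𝓘(ℝ, E) G) (M := GroupLieAlgebra 𝓘(ℝ, E) G) X Y

variable (G) in
/-- A left-invariant vector field in the chart at the identity. -/
def chartField (Y : E) (x : E) : E :=
  VectorField.mpullbackWithin 𝓘(ℝ, E) 𝓘(ℝ, E) (extChartAt 𝓘(ℝ, E) (1 : G)).symm
    (mulInvariantVectorField (I := 𝓘(ℝ, E)) (G := G) Y) (Set.range 𝓘(ℝ, E)) x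

theorem chartField_eq (Y : E) {x : E}
    (hx : x ∈ (extChartAt 𝓘(ℝ, E) (1 : G)).target)
    (h1 : DifferentiableAt ℝ (chartMul E G) (x, chartOne E G)) :
    chartField G Y x = fderiv ℝ (chartMul E G) (x, chartOne E G) (0, (Y : E)) := by
  rw [fderiv_chartMul_right h1 (mdifferentiableAt_chart_mul_left hx)]
  set g := (extChartAt 𝓘(ℝ, E) (1 : G)).symm x with hg
  have hinv : (mfderivWithin 𝓘(ℝ, E) 𝓘(ℝ, E) (extChartAt 𝓘(ℝ, E) (1 : G)).symm
      (Set.range 𝓘(ℝ, E)) x).inverse = mfderiv 𝓘(ℝ, E) 𝓘(ℝ, E) (extChartAt 𝓘(ℝ, E) (1 : G)) g :=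
    ContinuousLinearMap.inverse_eq
      (mfderivWithin_extChartAt_symm_comp_mfderiv_extChartAt hx)
      (mfderiv_extChartAt_comp_mfderivWithin_extChartAt_symm hx)
  have e1 : chartField G Y x = (mfderiv 𝓘(ℝ, E) 𝓘(ℝ, E) (extChartAt 𝓘(ℝ, E) (1 : G)) g : E →L[ℝ] E)
      ((mfderiv 𝓘(ℝ, E) 𝓘(ℝ, E) (fun h : G => g * h) 1 : E →L[ℝ] E) Y) :=
    congrArg (fun T : E →L[ℝ] E => T ((mfderiv 𝓘(ℝ, E) 𝓘(ℝ, E) (fun h : G => g * h) 1 : E →L[ℝ] E) Y)) hinv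
  have hgs : g * 1 ∈ (chartAt E (1 : G)).source := by
    rw [mul_one, ← extChartAt_source 𝓘(ℝ, E)]; exact (extChartAt 𝓘(ℝ, E) (1 : G)).map_target hx
  have h3 := mfderiv_comp (I := 𝓘(ℝ, E)) (I' := 𝓘(ℝ, E)) (I'' := 𝓘(ℝ, E)) (1 : G)
    (mdifferentiableAt_extChartAt hgs)
    ((contMDiff_mul_left (I := 𝓘(ℝ, E)) (n := ∞) (a := g)).mdifferentiableAt (by simp) (x := 1))
  have h4 := mfderiv_point (E := E) (F := E) (extChartAt 𝓘(ℝ, E) (1 : G)) (mul_one g)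
  rw [e1]
  refine (congrArg (fun T : E →L[ℝ] E =>
    T ((mfderiv 𝓘(ℝ, E) 𝓘(ℝ, E) (fun h : G => g * h) 1 : E →L[ℝ] E) Y)) h4).symm.trans ?_
  exact (congrArg (fun T : E →L[ℝ] E => T Y) h3).symm

theorem lie_eq_fderiv_chartField (X Y : E) :
    modelBracket E G X Y = fderiv ℝ (chartField G Y) (chartOne E G) (chartField G X (chartOne E G)) -
      fderiv ℝ (chartField G X) (chartOne E G) (chartField G Y (chartOne E G)) := by
  -- The bracket is computed in the chart and pulled back by the chart's derivative at 1, which is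
  -- the identity.
  have h1 : ∀ T : E →L[ℝ] E, (mfderiv 𝓘(ℝ, E) 𝓘(ℝ, E) (extChartAt 𝓘(ℝ, E) (1 : G)) 1 : E →L[ℝ] E) = T →
      modelBracket E G X Y = T.inverse
        (VectorField.lieBracketWithin ℝ (chartField G X) (chartField G Y)
          ((extChartAt 𝓘(ℝ, E) (1 : G)).symm ⁻¹' Set.univ ∩ Set.range 𝓘(ℝ, E)) (chartOne E G)) := by
    rintro _ rfl; rfl
  have h2 := h1 (ContinuousLinearMap.id ℝ E) mfderiv_extChartAt_self
  have h3 : ((extChartAt 𝓘(ℝ, E) (1 : G)).symm ⁻¹' Set.univ ∩ Set.range 𝓘(ℝ, E)) = Set.univ := by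
    simp
  rw [h2, h3, ContinuousLinearMap.inverse_id, VectorField.lieBracketWithin_univ]
  rfl

theorem fderiv_chartMul_one_zero_right (X : E) :
    fderiv ℝ (chartMul E G) (chartOne E G, chartOne E G) (0, X) = X := by
  have h0 := (contDiffAt_chartMul (E := E) (G := G)).differentiableAt (by simp)
  have h1 := HasFDerivAt.comp (f := fun e : E => (chartOne E G, e)) (chartOne E G) h0.hasFDerivAt
    (hasFDerivAt_prodMk_right (𝕜 := ℝ) (chartOne E G) (chartOne E G))
  have h2 := h1.unique ((hasFDerivAt_id (𝕜 := ℝ) (chartOne E G)).congr_of_eventuallyEq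
    chartMul_one_left_eventuallyEq)
  exact congrArg (fun T : E →L[ℝ] E => T X) h2

theorem fderiv_chartMul_one_zero_left (X : E) :
    fderiv ℝ (chartMul E G) (chartOne E G, chartOne E G) (X, 0) = X := by
  have h0 := (contDiffAt_chartMul (E := E) (G := G)).differentiableAt (by simp)
  have h1 := HasFDerivAt.comp (f := fun e : E => (e, chartOne E G)) (chartOne E G) h0.hasFDerivAt
    (hasFDerivAt_prodMk_left (𝕜 := ℝ) (chartOne E G) (chartOne E G))
  have h2 := h1.unique ((hasFDerivAt_id (𝕜 := ℝ) (chartOne E G)).congr_of_eventuallyEq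
    chartMul_one_right_eventuallyEq)
  exact congrArg (fun T : E →L[ℝ] E => T X) h2

theorem eventually_differentiableAt_chartMul :
    ∀ᶠ p in nhds (chartOne E G, chartOne E G), DifferentiableAt ℝ (chartMul E G) p := by
  have h := (contDiffAt_chartMul (E := E) (G := G)).of_le (m := 1) (by exact_mod_cast le_top)
  filter_upwards [h.eventually (by norm_num)] with p hp
  exact hp.differentiableAt (by simp)

theorem hasFDerivAt_fderiv_chartMul :
    HasFDerivAt (fderiv ℝ (chartMul E G))
      (fderiv ℝ (fderiv ℝ (chartMul E G)) (chartOne E G, chartOne E G))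
      (chartOne E G, chartOne E G) :=
  (((contDiffAt_chartMul (E := E) (G := G)).fderiv_right (m := 1) (WithTop.coe_le_coe.2 le_top)).differentiableAt
    (by simp)).hasFDerivAt

theorem hasFDerivAt_chartField (Y : E) :
    HasFDerivAt (chartField G Y) (((ContinuousLinearMap.apply ℝ E ((0, Y) : E × E)).comp
      (fderiv ℝ (fderiv ℝ (chartMul E G)) (chartOne E G, chartOne E G))).comp
        (ContinuousLinearMap.inl ℝ E E)) (chartOne E G) := by
  have h1 := HasFDerivAt.comp (f := fun e : E => (e, chartOne E G)) (chartOne E G)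
    (((ContinuousLinearMap.apply ℝ E ((0, Y) : E × E)).hasFDerivAt).comp _
      (hasFDerivAt_fderiv_chartMul (E := E) (G := G)))
    (hasFDerivAt_prodMk_left (𝕜 := ℝ) (chartOne E G) (chartOne E G))
  refine h1.congr_of_eventuallyEq ?_
  have h2 : Filter.Tendsto (fun e : E => (e, chartOne E G)) (nhds (chartOne E G))
      (nhds (chartOne E G, chartOne E G)) :=
    (Continuous.prodMk_left (chartOne E G)).tendsto _
  filter_upwards [target_mem_nhds_chartOne (E := E) (G := G),
    h2.eventually eventually_differentiableAt_chartMul] with x hx hx'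
  exact chartField_eq Y hx hx'

/-- The Lie bracket as the antisymmetrized second derivative of the product. -/
theorem lie_eq_fderiv_fderiv (X Y : E) :
    modelBracket E G X Y =
      fderiv ℝ (fderiv ℝ (chartMul E G)) (chartOne E G, chartOne E G) (X, 0) (0, Y) -
      fderiv ℝ (fderiv ℝ (chartMul E G)) (chartOne E G, chartOne E G) (Y, 0) (0, X) := by
  have hX : ∀ X : E, chartField G X (chartOne E G) = X := fun X =>
    (chartField_eq X (mem_of_mem_nhds target_mem_nhds_chartOne)
      (eventually_differentiableAt_chartMul.self_of_nhds)).trans (fderiv_chartMul_one_zero_right X)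
  rw [lie_eq_fderiv_chartField, hX, hX, (hasFDerivAt_chartField (G := G) X).fderiv,
    (hasFDerivAt_chartField (G := G) Y).fderiv]
  rfl

theorem mdifferentiableAt_AdL_apply (Y : E) (g : G) :
    MDifferentiableAt 𝓘(ℝ, E) 𝓘(ℝ, E) (fun g : G => AdL g Y) g := by
  have := (ContinuousLinearMap.apply ℝ E Y).contMDiff.comp (contMDiff_AdL (E := E) (G := G)) (n := ∞)
  exact this.mdifferentiableAt (by simp)

/-- The differential of the adjoint representation is the Lie bracket. -/
theorem mfderiv_AdL_apply (X Y : E) :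
    (mfderiv 𝓘(ℝ, E) 𝓘(ℝ, E) (fun g : G => AdL g (Y : E)) 1 : E →L[ℝ] E) X = modelBracket E G X Y := by
  set D := fderiv ℝ (fderiv ℝ (chartMul E G)) (chartOne E G, chartOne E G) with hD
  set a : E → E := (fun g : G => AdL g (Y : E)) ∘ (extChartAt 𝓘(ℝ, E) (1 : G)).symm with ha
  have h1 := fderiv_comp_extChartAt_symm (mdifferentiableAt_AdL_apply (Y : E) (1 : G))
  generalize ((mfderiv 𝓘(ℝ, E) 𝓘(ℝ, E) (fun g : G => AdL g (Y : E)) 1 : E →L[ℝ] E)) = a' at h1 ⊢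
  change E →L[ℝ] E at a'
  change a' X = modelBracket E G X Y
  have h1' : HasFDerivAt (fun x => ((a x, 0) : E × E)) ((ContinuousLinearMap.inl ℝ E E).comp a')
    (chartOne E G) := (ContinuousLinearMap.inl ℝ E E).hasFDerivAt.comp _ h1
  have h2 := HasFDerivAt.comp (f := fun e : E => (chartOne E G, e)) (chartOne E G)
    (hasFDerivAt_fderiv_chartMul (E := E) (G := G))
    (hasFDerivAt_prodMk_right (𝕜 := ℝ) (chartOne E G) (chartOne E G))
  have h3 := h2.clm_apply h1'
  have h4 : Filter.Tendsto (fun e : E => (e, chartOne E G)) (nhds (chartOne E G))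
      (nhds (chartOne E G, chartOne E G)) :=
    (Continuous.prodMk_left (chartOne E G)).tendsto _
  have h5 : Filter.Tendsto (fun e : E => (chartOne E G, e)) (nhds (chartOne E G))
      (nhds (chartOne E G, chartOne E G)) :=
    (Continuous.prodMk_right (chartOne E G)).tendsto _
  have h6 := h3.congr_of_eventuallyEq (f₁ := chartField G Y) (by
    filter_upwards [target_mem_nhds_chartOne (E := E) (G := G),
      h4.eventually eventually_differentiableAt_chartMul,
      h5.eventually eventually_differentiableAt_chartMul] with x hx hx' hx''
    exact (chartField_eq Y hx hx').trans (fderiv_chartMul_eq hx hx' hx'' Y))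
  have h7 := congrArg (fun T : E →L[ℝ] E => T X) ((hasFDerivAt_chartField (G := G) Y).unique h6)
  have ha1 : a (chartOne E G) = Y := by
    rw [ha, Function.comp_apply, symm_chartOne, AdL_one]; rfl
  have hsymm : D (0, X) (Y, 0) = D (Y, 0) (0, X) := by
    have : IsSymmSndFDerivAt ℝ (chartMul E G) (chartOne E G, chartOne E G) :=
      (contDiffAt_chartMul (E := E) (G := G)).isSymmSndFDerivAt (by simp; exact WithTop.coe_le_coe.2 le_top)
    exact this _ _
  -- With m the product in the chart and e its origin, this differentiates ∂₂m(x, e) Y = ∂₁m(e, x)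
  -- (Ad(x) Y) at x = e along X. Symmetry of the second derivative then leaves the bracket.
  have h8 : D (X, 0) (0, Y) = a' X + D (0, X) (Y, 0) := by
    have h9 := fderiv_chartMul_one_zero_left (E := E) (G := G) (a' X)
    simp only [ContinuousLinearMap.comp_apply, add_apply,
      ContinuousLinearMap.flip_apply, ContinuousLinearMap.inl_apply, ContinuousLinearMap.inr_apply,
      ContinuousLinearMap.apply_apply, Function.comp_apply, ha1] at h7
    rw [h9] at h7
    exact h7
  rw [lie_eq_fderiv_fderiv, ← hD, h8, hsymm, add_sub_cancel_right]

end AdjointRepresentation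

/-! ### Adapting an invariant inner product to the Killing form. -/

section InvariantForm

/-- The square of a map that is skew for an inner product has non-positive trace, and vanishing
trace only if the map is zero. -/
theorem trace_comp_self_of_skew {V : Type*} [AddCommGroup V] [Module ℝ V] [FiniteDimensional ℝ V]
    {β : LinearMap.BilinForm ℝ V} (hs : ∀ x y, β x y = β y x) (hp : ∀ x, x ≠ 0 → 0 < β x x)
    {T : V →ₗ[ℝ] V} (hT : ∀ x y, β (T x) y = -β x (T y)) :
    LinearMap.trace ℝ V (T ∘ₗ T) ≤ 0 ∧ (LinearMap.trace ℝ V (T ∘ₗ T) = 0 → T = 0) := by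
  have hp' : ∀ x, 0 ≤ β x x := fun x => by
    by_cases h : x = 0
    · simp [h]
    · exact (hp x h).le
  have hz : ∀ x, β x x = 0 → x = 0 := fun x hx => by
    by_contra h
    exact (hp x h).ne' hx
  let core : InnerProductSpace.Core ℝ V :=
    { inner := fun x y => β x y
      conj_inner_symm := fun x y => (hs y x)
      re_inner_nonneg := hp'
      add_left := fun x y z => by simp
      smul_left := fun x y r => by simp
      definite := hz }
  let _ : NormedAddCommGroup V := core.toNormedAddCommGroup
  let _ : InnerProductSpace ℝ V := InnerProductSpace.ofCore core.toCore
  have b := stdOrthonormalBasis ℝ V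
  have e : LinearMap.trace ℝ V (T ∘ₗ T) = -∑ i, β (T (b i)) (T (b i)) := by
    rw [LinearMap.trace_eq_sum_inner _ b, ← Finset.sum_neg_distrib]
    refine Finset.sum_congr rfl fun i _ => ?_
    rw [hT, neg_neg]
    rfl
  have hsum : 0 ≤ ∑ i, β (T (b i)) (T (b i)) := Finset.sum_nonneg fun i _ => hp' _
  refine ⟨by rw [e]; linarith, fun h => ?_⟩
  rw [e, neg_eq_zero, Finset.sum_eq_zero_iff_of_nonneg fun i _ => hp' _] at h
  exact b.toBasis.ext fun i => by simpa using hz _ (h i (Finset.mem_univ i))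

variable {𝔨₀ : Type*} [LieRing 𝔨₀] [LieAlgebra ℝ 𝔨₀] [FiniteDimensional ℝ 𝔨₀]

/-- The orthogonal projection to the center. -/
theorem exists_center_projection {β : LinearMap.BilinForm ℝ 𝔨₀} (hs : ∀ x y, β x y = β y x)
    (hp : ∀ x, x ≠ 0 → 0 < β x x) :
    ∃ π : 𝔨₀ →ₗ[ℝ] 𝔨₀, (∀ x y : 𝔨₀, ⁅y, π x⁆ = 0) ∧
      ∀ x z : 𝔨₀, (∀ y : 𝔨₀, ⁅y, z⁆ = 0) → β (x - π x) z = 0 := by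
  set Z : Submodule ℝ 𝔨₀ := (LieModule.maxTrivSubmodule ℝ 𝔨₀ 𝔨₀).toSubmodule with hZ
  have hmem : ∀ z, z ∈ Z ↔ ∀ y : 𝔨₀, ⁅y, z⁆ = 0 := fun z => LieModule.mem_maxTrivSubmodule ..
  have hr : β.IsRefl := fun x y h => by rw [hs, h]
  have hnd : (β.restrict Z).Nondegenerate := by
    refine ⟨fun x hx => ?_, fun x hx => ?_⟩ <;>
    · by_contra h
      exact (hp x fun h0 => h (Subtype.ext h0)).ne' (hx x)
  have hc := LinearMap.BilinForm.isCompl_orthogonal_of_restrict_nondegenerate hr hnd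
  refine ⟨Z.projection _ hc, fun x y => (hmem _).1 (Submodule.projection_apply_mem hc x) y,
    fun x z hz => ?_⟩
  have := Submodule.sub_projection_mem hc x
  rw [hs]
  exact this z ((hmem z).2 hz)

/-- An invariant inner product yields one that is adapted to the Killing form. -/
theorem exists_isCompactForm {β : LinearMap.BilinForm ℝ 𝔨₀} (hs : ∀ x y, β x y = β y x)
    (hp : ∀ x, x ≠ 0 → 0 < β x x) (hi : ∀ x y z : 𝔨₀, β ⁅x, y⁆ z = -β y ⁅x, z⁆) :
    ∃ β' : LinearMap.BilinForm ℝ 𝔨₀, IsCompactForm β' ∧ ∀ u : 𝔨₀ ≃ₗ[ℝ] 𝔨₀,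
      (∀ x y : 𝔨₀, u ⁅x, y⁆ = ⁅u x, u y⁆) → (∀ x y, β (u x) (u y) = β x y) →
      ∀ x y, β' (u x) (u y) = β' x y := by
  obtain ⟨π, hπ, hπ'⟩ := exists_center_projection hs hp
  have hu : ∀ x c : 𝔨₀, (∀ y : 𝔨₀, ⁅y, c⁆ = 0) →
      (∀ z : 𝔨₀, (∀ y : 𝔨₀, ⁅y, z⁆ = 0) → β (x - c) z = 0) → π x = c := by
    -- The difference of two such projections is central and orthogonal to the center, hence zero.
    -- All later identities for π come from this uniqueness.
    intro x c hc h
    have h0 : ∀ y : 𝔨₀, ⁅y, π x - c⁆ = 0 := fun y => by rw [lie_sub, hπ, hc, sub_zero]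
    by_contra hne
    refine (hp (π x - c) (sub_ne_zero.2 hne)).ne' ?_
    have e : π x - c = (x - c) - (x - π x) := by abel
    have e' := congrArg (fun w => β w (π x - c)) e
    exact e'.trans (by rw [LinearMap.map_sub₂, h _ h0, hπ' _ _ h0, sub_zero])
  have hππ : ∀ x, π (π x) = π x := fun x => hu _ _ (hπ x) fun z _ => by simp
  have hκc : ∀ x y : 𝔨₀, killingForm ℝ 𝔨₀ (π x) y = 0 := fun x y => by
    have : LieAlgebra.ad ℝ 𝔨₀ (π x) = 0 := by
      ext z
      rw [LieAlgebra.ad_apply, ← lie_skew, hπ, neg_zero, LinearMap.zero_apply]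
    rw [killingForm_apply_apply, this, LinearMap.zero_comp, map_zero]
  have hπl : ∀ x y : 𝔨₀, π ⁅x, y⁆ = 0 := fun x y =>
    hu _ _ (fun y => by simp) fun z hz => by rw [sub_zero, hi, hz, map_zero, neg_zero]
  have hκ : ∀ x : 𝔨₀, killingForm ℝ 𝔨₀ x x ≤ 0 ∧
      (killingForm ℝ 𝔨₀ x x = 0 → LieAlgebra.ad ℝ 𝔨₀ x = 0) := fun x => by
    rw [killingForm_apply_apply]
    exact trace_comp_self_of_skew hs hp fun y z => hi x y z
  -- -κ is positive semidefinite with kernel the center, where the second term is positive definite.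
  -- That term is invariant because π kills brackets.
  refine ⟨-killingForm ℝ 𝔨₀ + β.compl₁₂ π π, ⟨fun x y => ?_, fun x hx => ?_, fun x y z => ?_,
    π, fun x y => ?_, fun x y => ?_⟩, fun u hl hβ x y => ?_⟩
  · simp only [LinearMap.add_apply, LinearMap.neg_apply, LinearMap.compl₁₂_apply]
    rw [LieModule.traceForm_comm, hs]
  · simp only [LinearMap.add_apply, LinearMap.neg_apply, LinearMap.compl₁₂_apply]
    have h1 : 0 ≤ β (π x) (π x) := by
      by_cases h : π x = 0
      · simp [h]
      · exact (hp _ h).le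
    rcases (hκ x).1.lt_or_eq with h | h
    · linarith
    · have hx' : π x = x := hu _ _ (fun y => by
        rw [← lie_skew, ← LieAlgebra.ad_apply ℝ, (hκ x).2 h, LinearMap.zero_apply, neg_zero])
        fun z _ => by simp
      rw [hx', h, neg_zero, zero_add]
      exact hp x hx
  · simp only [LinearMap.add_apply, LinearMap.neg_apply, LinearMap.compl₁₂_apply]
    rw [hπl, hπl, ← lie_skew, map_neg, LinearMap.neg_apply, LieModule.traceForm_apply_lie_apply]
    simp
  · rw [← lie_skew, hπ, neg_zero]
  · simp only [LinearMap.add_apply, LinearMap.neg_apply, LinearMap.compl₁₂_apply]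
    rw [hκc, hππ, neg_zero, zero_add]
  · have hc : ∀ z : 𝔨₀, (∀ y : 𝔨₀, ⁅y, z⁆ = 0) → ∀ y : 𝔨₀, ⁅y, u z⁆ = 0 := fun z hz y => by
      rw [← u.apply_symm_apply y, ← hl, hz, map_zero]
    have hc' : ∀ z : 𝔨₀, (∀ y : 𝔨₀, ⁅y, z⁆ = 0) → ∀ y : 𝔨₀, ⁅y, u.symm z⁆ = 0 := fun z hz y => by
      apply u.injective
      rw [hl, u.apply_symm_apply, hz, map_zero]
    have hπu : ∀ x, π (u x) = u (π x) := fun x => hu _ _ (hc _ (hπ x)) fun z hz => by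
      rw [← map_sub, ← u.apply_symm_apply z, hβ]
      exact hπ' _ _ (hc' z hz)
    let e : 𝔨₀ ≃ₗ⁅ℝ⁆ 𝔨₀ := { u with map_lie' := fun {x y} => hl x y }
    have he := LieAlgebra.killingForm_of_equiv_apply e x y
    simp only [LinearMap.add_apply, LinearMap.neg_apply, LinearMap.compl₁₂_apply]
    rw [hπu, hπu, hβ]
    congr 2

end InvariantForm

/-! ### Automorphisms and infinitesimal invariance from the group. -/

section CompactGroup

variable {E : Type*} [NormedAddCommGroup E] [NormedSpace ℝ E]
  {G : Type*} [TopologicalSpace G] [ChartedSpace E G] [Group G] [LieGroup 𝓘(ℝ, E) ∞ G]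

theorem AdL_inv_apply (g : G) (X : E) : AdL g⁻¹ (AdL g X) = X := by
  rw [← ContinuousLinearMap.comp_apply, ← AdL_mul, inv_mul_cancel, AdL_one]
  rfl

theorem AdL_apply_inv (g : G) (X : E) : AdL g (AdL g⁻¹ X) = X := by
  rw [← ContinuousLinearMap.comp_apply, ← AdL_mul, mul_inv_cancel, AdL_one]
  rfl

/-- The adjoint representation acts by automorphisms of the bracket. -/
theorem AdL_modelBracket (h : G) (X Y : E) :
    AdL h (modelBracket E G X Y) = modelBracket E G (AdL h X) (AdL h Y) := by
  set f : G → E := fun g => AdL g (AdL h Y) with hf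
  -- Differentiating Ad(h g h⁻¹) Ad(h) Y = Ad(h) Ad(g) Y at g = 1 along X yields the claim.
  have e : f ∘ (fun g => h * g * h⁻¹) = (AdL (E := E) h) ∘ (fun g : G => AdL (E := E) g Y) := by
    ext1 g
    simp only [hf, Function.comp_apply, AdL_mul, ContinuousLinearMap.comp_apply, AdL_inv_apply]
  have h1 := mfderiv_comp (I := 𝓘(ℝ, E)) (I' := 𝓘(ℝ, E)) (I'' := 𝓘(ℝ, E)) (1 : G)
    (mdifferentiableAt_AdL_apply (E := E) (AdL h Y) (h * 1 * h⁻¹))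
    ((contMDiff_conj_right (E := E) h).mdifferentiableAt (by simp) (x := 1))
  have h2 := mfderiv_comp (I := 𝓘(ℝ, E)) (I' := 𝓘(ℝ, E)) (I'' := 𝓘(ℝ, E)) (1 : G)
    ((AdL (E := E) h).mdifferentiableAt (x := AdL (1 : G) Y))
    (mdifferentiableAt_AdL_apply (E := E) Y (1 : G))
  have h3 := mfderiv_point (E := E) (F := E) f (show h * 1 * h⁻¹ = 1 by simp)
  have h4 : (mfderiv 𝓘(ℝ, E) 𝓘(ℝ, E) (f ∘ (fun g => h * g * h⁻¹)) 1 : E →L[ℝ] E) X =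
      modelBracket E G (AdL h X) (AdL h Y) := by
    refine (congrArg (fun T : E →L[ℝ] E => T X) h1).trans ?_
    refine (congrArg (fun T : E →L[ℝ] E => T (AdL h X)) h3).trans ?_
    exact mfderiv_AdL_apply (AdL h X) (AdL h Y)
  have h5 : (mfderiv 𝓘(ℝ, E) 𝓘(ℝ, E) ((AdL (E := E) h) ∘ (fun g : G => AdL (E := E) g Y)) 1 :
      E →L[ℝ] E) X = AdL h (modelBracket E G X Y) := by
    refine (congrArg (fun T : E →L[ℝ] E => T X) h2).trans ?_
    refine (congrArg (fun T : E →L[ℝ] E => T ((mfderiv 𝓘(ℝ, E) 𝓘(ℝ, E)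
      (fun g : G => AdL g (Y : E)) 1 : E →L[ℝ] E) X)) (AdL (E := E) h).mfderiv_eq).trans ?_
    rw [mfderiv_AdL_apply]
  rw [← h4, ← h5, e]

/-- A bilinear form that is invariant under the group is invariant under its Lie algebra. -/
theorem modelBracket_invariant (B : E →L[ℝ] E →L[ℝ] ℝ)
    (hB : ∀ (g : G) (X Y : E), B (AdL g X) (AdL g Y) = B X Y) (X Y Z : E) :
    B (modelBracket E G X Y) Z = -B Y (modelBracket E G X Z) := by
  have hd : ∀ Y : E, ∃ T : E →L[ℝ] E, (∀ X, T X = modelBracket E G X Y) ∧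
      HasFDerivAt ((fun g : G => AdL g Y) ∘ (extChartAt 𝓘(ℝ, E) (1 : G)).symm) T
        (chartOne E G) := fun Y =>
    ⟨_, fun X => mfderiv_AdL_apply X Y,
      fderiv_comp_extChartAt_symm (mdifferentiableAt_AdL_apply (Y : E) (1 : G))⟩
  have h1 : ∀ Y : E, ((fun g : G => AdL g Y) ∘ (extChartAt 𝓘(ℝ, E) (1 : G)).symm)
      (chartOne E G) = Y := fun Y => by
    rw [Function.comp_apply, symm_chartOne, AdL_one]; rfl
  obtain ⟨S, hS, hS'⟩ := hd Y
  obtain ⟨T, hT, hT'⟩ := hd Z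
  have h2 := B.hasFDerivAt_of_bilinear hS' hT'
  have h3 : (fun x => B (((fun g : G => AdL g Y) ∘ (extChartAt 𝓘(ℝ, E) (1 : G)).symm) x)
      (((fun g : G => AdL g Z) ∘ (extChartAt 𝓘(ℝ, E) (1 : G)).symm) x)) = fun _ => B Y Z := by
    ext x
    exact hB _ _ _
  rw [h3, h1, h1] at h2
  have h4 := congrArg (fun T : E →L[ℝ] ℝ => T X) (h2.unique (hasFDerivAt_const _ _))
  have h5 : B Y (T X) + B (S X) Z = 0 := h4
  rw [hS, hT] at h5
  linarith

/-- `Ad g` as a linear equivalence. -/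
def AdEquiv (g : G) : GroupLieAlgebra 𝓘(ℝ, E) G ≃ₗ[ℝ] GroupLieAlgebra 𝓘(ℝ, E) G :=
  LinearEquiv.ofLinearMap (Ad g) (Ad g⁻¹) (LinearMap.ext fun X => AdL_apply_inv (E := E) g X)
    (LinearMap.ext fun X => AdL_inv_apply (E := E) g X)

theorem AdEquiv_lie (g : G) (X Y : GroupLieAlgebra 𝓘(ℝ, E) G) :
    AdEquiv g ⁅X, Y⁆ = ⁅AdEquiv g X, AdEquiv g Y⁆ := AdL_modelBracket (E := E) g X Y

end CompactGroup

/-! ### Averaging over Haar measure. -/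

section Haar

variable {E : Type*} [NormedAddCommGroup E] [InnerProductSpace ℝ E] [FiniteDimensional ℝ E]
  {G : Type*} [TopologicalSpace G] [CompactSpace G] [ChartedSpace E G] [Group G]
  [LieGroup 𝓘(ℝ, E) ∞ G]

variable (E G) in
/-- Averaging over a compact group gives an inner product that is invariant under the adjoint
representation. -/
theorem exists_AdL_invariant_inner : ∃ B : E →L[ℝ] E →L[ℝ] ℝ, (∀ X Y, B X Y = B Y X) ∧
    (∀ X, X ≠ 0 → 0 < B X X) ∧ ∀ (g : G) (X Y : E), B (AdL g X) (AdL g Y) = B X Y := by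
  have : IsTopologicalGroup G := topologicalGroup_of_lieGroup 𝓘(ℝ, E) ∞
  let _ : MeasurableSpace G := borel G
  have : BorelSpace G := ⟨rfl⟩
  let μ : MeasureTheory.Measure G := MeasureTheory.Measure.haar
  have hA : Continuous fun g : G => AdL (E := E) g⁻¹ :=
    (contMDiff_AdL (E := E) (G := G)).continuous.comp continuous_inv
  have hAX : ∀ X : E, Continuous fun g : G => AdL (E := E) g⁻¹ X := fun X =>
    (ContinuousLinearMap.apply ℝ E X).continuous.comp hA
  have hc : ∀ X Y : E, Continuous fun g : G => inner ℝ (AdL (E := E) g⁻¹ X) (AdL g⁻¹ Y) :=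
    fun X Y => (hAX X).inner (hAX Y)
  have hi : ∀ X Y : E, MeasureTheory.Integrable
      (fun g : G => inner ℝ (AdL (E := E) g⁻¹ X) (AdL g⁻¹ Y)) μ := fun X Y =>
    (hc X Y).integrable_of_hasCompactSupport (HasCompactSupport.of_compactSpace _)
  -- The integrand uses g⁻¹ so that left invariance of the measure, under g ↦ h⁻¹ g, gives
  -- invariance of the average under Ad(h).
  let B : E →ₗ[ℝ] E →ₗ[ℝ] ℝ := LinearMap.mk₂ ℝ
    (fun X Y => ∫ g : G, inner ℝ (AdL (E := E) g⁻¹ X) (AdL g⁻¹ Y) ∂μ)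
    (fun X X' Y => by
      simp only [map_add, inner_add_left]
      exact MeasureTheory.integral_add (hi X Y) (hi X' Y))
    (fun c X Y => by
      simp only [map_smul, real_inner_smul_left, smul_eq_mul]
      exact MeasureTheory.integral_const_mul c _)
    (fun X Y Y' => by
      simp only [map_add, inner_add_right]
      exact MeasureTheory.integral_add (hi X Y) (hi X Y'))
    (fun c X Y => by
      simp only [map_smul, real_inner_smul_right, smul_eq_mul]
      exact MeasureTheory.integral_const_mul c _)
  have hB : ∀ X Y : E, B.toContinuousBilinearMap X Y =
      ∫ g : G, inner ℝ (AdL (E := E) g⁻¹ X) (AdL g⁻¹ Y) ∂μ := fun X Y => rfl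
  refine ⟨B.toContinuousBilinearMap, fun X Y => ?_, fun X hX => ?_, fun h X Y => ?_⟩
  · rw [hB, hB]
    simp only [real_inner_comm]
  · rw [hB]
    refine Continuous.integral_pos_of_hasCompactSupport_nonneg_nonzero (x := (1 : G))
      (hc X X) (HasCompactSupport.of_compactSpace _) (fun g => real_inner_self_nonneg) ?_
    rw [inv_one, AdL_one]
    simpa using hX
  · rw [hB, hB, ← MeasureTheory.integral_mul_left_eq_self
      (fun g => inner ℝ (AdL (E := E) g⁻¹ X) (AdL g⁻¹ Y)) h⁻¹]
    simp only [mul_inv_rev, inv_inv, AdL_mul, ContinuousLinearMap.comp_apply]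

end Haar

/-! ### The compact form on the Lie algebra of a compact group. -/

section GroupLieAlgebra

variable {E : Type*} [NormedAddCommGroup E] [InnerProductSpace ℝ E] [FiniteDimensional ℝ E]
  {G : Type*} [TopologicalSpace G] [ChartedSpace E G] [Group G]
  [LieGroup 𝓘(ℝ, E) ∞ G]

variable (E G) in
/-- The Lie algebra of a compact group carries a compact form that is invariant under the group. -/
theorem exists_isCompactForm_groupLieAlgebra [CompactSpace G] [CompleteSpace E] :
    ∃ β : LinearMap.BilinForm ℝ (GroupLieAlgebra 𝓘(ℝ, E) G), IsCompactForm β ∧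
      ∀ (g : G) (X Y), β (AdEquiv g X) (AdEquiv g Y) = β X Y := by
  have : FiniteDimensional ℝ (GroupLieAlgebra 𝓘(ℝ, E) G) := ‹FiniteDimensional ℝ E›
  obtain ⟨B, hs, hp, hB⟩ := exists_AdL_invariant_inner E G
  let β₀ : LinearMap.BilinForm ℝ (GroupLieAlgebra 𝓘(ℝ, E) G) := B.toLinearMap₁₂
  obtain ⟨β, hβ, hu⟩ := exists_isCompactForm (β := β₀) hs hp (modelBracket_invariant B hB)
  exact ⟨β, hβ, fun g => hu (AdEquiv g) (AdEquiv_lie g) (hB g)⟩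

end GroupLieAlgebra

end CRLie

end

theorem mainTheorem11 {n : ℕ} {K₀ : Type*} [TopologicalSpace K₀] [T2Space K₀] [CompactSpace K₀]
    [ConnectedSpace K₀] [Group K₀] [ChartedSpace (EuclideanSpace ℝ (Fin n)) K₀]
    [LieGroup (𝓡 n) ∞ K₀] (M₀ : Subgroup K₀) (hM₀ : IsClosed (M₀ : Set K₀))
    (𝔳 : LieSubalgebra ℂ (ℂ ⊗[ℝ] GroupLieAlgebra (𝓡 n) K₀)) :
    CRLie.ParAdm 𝔳 M₀ =
      {𝔮 | ∃ A ∈ CRLie.adFixed M₀, 𝔳 ≤ CRLie.q A ∧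
        CRLie.nilr 𝔳 ∩ CRLie.leviPart (CRLie.q A) = {0} ∧ 𝔮 = CRLie.q A} ∧
    {𝔮 : LieSubalgebra ℂ (ℂ ⊗[ℝ] GroupLieAlgebra (𝓡 n) K₀) |
        CRLie.IsParabolic 𝔮 ∧ 𝔳 ≤ 𝔮 ∧ ∀ g ∈ M₀, CRLie.AdStable g 𝔮} =
      {𝔮 | ∃ A ∈ CRLie.adFixed M₀, 𝔳 ≤ CRLie.q A ∧ 𝔮 = CRLie.q A} := by
  obtain ⟨β, hβ, hinv⟩ :=
    CRLie.exists_isCompactForm_groupLieAlgebra (EuclideanSpace ℝ (Fin n)) K₀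
  have hfd : FiniteDimensional ℝ (GroupLieAlgebra (𝓡 n) K₀) :=
    inferInstanceAs (FiniteDimensional ℝ (EuclideanSpace ℝ (Fin n)))
  -- Both equalities reduce to this one: the conditions involving 𝔳 concern only the subalgebra 𝔮
  -- and carry over unchanged once 𝔮 = 𝔮_A.
  have hq : ∀ 𝔮 : LieSubalgebra ℂ (ℂ ⊗[ℝ] GroupLieAlgebra (𝓡 n) K₀),
      (CRLie.IsParabolic 𝔮 ∧ ∀ g ∈ M₀, CRLie.AdStable g 𝔮) ↔
        ∃ A ∈ CRLie.adFixed M₀, 𝔮 = CRLie.q A := by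
    intro 𝔮
    constructor
    · rintro ⟨hp, hs⟩
      obtain ⟨A, hA, hu⟩ := hβ.exists_eq_q hp
      exact ⟨A, fun g hg => hu (CRLie.AdEquiv g) (CRLie.AdEquiv_lie g) (hinv g) (hs g hg), hA⟩
    · rintro ⟨A, hA, rfl⟩
      exact ⟨hβ.isParabolic_q A, fun g hg =>
        CRLie.map_q (𝔨₀ := GroupLieAlgebra (𝓡 n) K₀) (CRLie.AdEquiv g) (CRLie.AdEquiv_lie g)
          (hA g hg)⟩
  refine ⟨Set.ext fun 𝔮 => ⟨?_, ?_⟩, Set.ext fun 𝔮 => ⟨?_, ?_⟩⟩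
  · rintro ⟨⟨hp, hv, hn⟩, hs⟩
    obtain ⟨A, hA, rfl⟩ := (hq 𝔮).1 ⟨hp, hs⟩
    exact ⟨A, hA, hv, hn, rfl⟩
  · rintro ⟨A, hA, hv, hn, rfl⟩
    obtain ⟨hp, hs⟩ := (hq _).2 ⟨A, hA, rfl⟩
    exact ⟨⟨hp, hv, hn⟩, hs⟩
  · rintro ⟨hp, hv, hs⟩
    obtain ⟨A, hA, rfl⟩ := (hq 𝔮).1 ⟨hp, hs⟩
    exact ⟨A, hA, hv, rfl⟩
  · rintro ⟨A, hA, hv, rfl⟩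
    obtain ⟨hp, hs⟩ := (hq _).2 ⟨A, hA, rfl⟩
    exact ⟨hp, hv, hs⟩
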